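/- Let $\Omega\subset\mathbb C^n$ be a bounded domain which is complete circular, that is, $tz\in\Omega$ for all $z\in\Omega$ and $t\in\mathbb C$ with $|t|\le 1$. For $0<p<\infty$ let $A^p(\Omega)$ be the space of holomorphic functions $f$ on $\Omega$ with $\|f\|_p=\left(\int_\Omega|f|^p\right)^{1/p}<\infty$ (Lebesgue measure), and put $$K_p(z)=\sup_{f\in A^p(\Omega)\setminus\{0\}}\frac{|f(z)|^p}{\|f\|_p^p},\qquad B_p(z;X)=K_p(z)^{-1/p}\sup_{\substack{f\in A^p(\Omega),\ f(z)=0\\ \|f\|_p>0}}\frac{|Xf(z)|}{\|f\|_p},$$ where $Xf=\sum_j X_j\,\partial f/\partial z_j$ for $X\in\mathbb C^n$. Write $$i\partial\bar\partial\log K_p(z;X)=\lim_{r\to0^+}\frac1{r^2}\left(\frac1{2\pi}\int_0^{2\pi}\log K_p(z+re^{i\theta}X)\,d\theta-\log K_p(z)\right)$$ for the (generalized) Levi form, which is the usual Levi form where $\log K_p$ is of class $C^2$. Then for every $X\in\mathbb C^n\setminus\{0\}$ and every real $p>0$ with $p\neq2$ this limit exists as a real number at $z=0$, and $$i\partial\bar\partial\log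 K_p(0;X)>B_p(0;X)^2\quad\text{if }p>2,\qquad i\partial\bar\partial\log K_p(0;X)<B_p(0;X)^2\quad\text{if }0<p<2.$$ -/

import Mathlib

open MeasureTheory Filter Topology

noncomputable section

/-- `f` belongs to the `p`-Bergman space `A^p(Ω)`: it is holomorphic on `Ω` and `|f|^p` is
integrable over `Ω` for Lebesgue measure.  Only the values of `f` on `Ω` matter below. -/
def MemBergman {n : ℕ} (p : ℝ) (Ω : Set (Fin n → ℂ)) (f : (Fin n → ℂ) → ℂ) : Prop :=
  DifferentiableOn ℂ f Ω ∧ IntegrableOn (fun z => ‖f z‖ ^ p) Ω volume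

/-- `‖f‖_p = (∫_Ω |f|^p)^{1/p}`, with respect to Lebesgue measure on `ℂⁿ`. -/
def bergmanNorm {n : ℕ} (p : ℝ) (Ω : Set (Fin n → ℂ)) (f : (Fin n → ℂ) → ℂ) : ℝ :=
  (∫ z in Ω, ‖f z‖ ^ p) ^ (1 / p)

/-- The `p`-Bergman kernel `K_p(z) = sup { |f(z)|^p / ‖f‖_p^p : f ∈ A^p(Ω), f ≠ 0 }`. -/
def bergmanKernel {n : ℕ} (p : ℝ) (Ω : Set (Fin n → ℂ)) (z : Fin n → ℂ) : ℝ :=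
  sSup {t : ℝ | ∃ f : (Fin n → ℂ) → ℂ, MemBergman p Ω f ∧ (∃ w ∈ Ω, f w ≠ 0) ∧
    t = ‖f z‖ ^ p / bergmanNorm p Ω f ^ p}

/-- The `p`-Bergman metric
`B_p(z;X) = K_p(z)^{-1/p} · sup { |Xf(z)| / ‖f‖_p : f ∈ A^p(Ω), f(z) = 0, ‖f‖_p > 0 }`,
where `Xf(z) = ∑ⱼ Xⱼ ∂f/∂zⱼ(z)` is the complex derivative of `f` at `z` in the direction `X`. -/
def bergmanMetric {n : ℕ} (p : ℝ) (Ω : Set (Fin n → ℂ)) (z X : Fin n → ℂ) : ℝ :=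
  bergmanKernel p Ω z ^ (-(1 / p)) *
    sSup {t : ℝ | ∃ f : (Fin n → ℂ) → ℂ, MemBergman p Ω f ∧ f z = 0 ∧ 0 < bergmanNorm p Ω f ∧
      t = ‖fderiv ℂ f z X‖ / bergmanNorm p Ω f}

/-- The generalized Levi form `i∂∂̄u(z;X)` exists and equals the real number `L`: the function
`u` is integrable on all small circles around `z` in the complex line through `z` in the
direction `X`, and
`r⁻² ( (1/2π) ∫_0^{2π} u(z + r e^{iθ} X) dθ - u(z) ) → L` as `r → 0⁺`.
The generalized Levi form is usually the lower limit of these quotients; here it is a limit.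
If `u` is of class `C²` near `z`, then `L = ∑ ∂²u/∂zⱼ∂z̄ₖ(z) Xⱼ X̄ₖ`. -/
def HasLeviForm {n : ℕ} (u : (Fin n → ℂ) → ℝ) (z X : Fin n → ℂ) (L : ℝ) : Prop :=
  (∀ᶠ r : ℝ in 𝓝[>] 0, CircleIntegrable (fun t : ℂ => u (z + t • X)) 0 r) ∧
  Tendsto (fun r : ℝ => (Real.circleAverage (fun t : ℂ => u (z + t • X)) 0 r - u z) / r ^ 2)
    (𝓝[>] 0) (𝓝 L)

end

/-! For every p the Levi form at 0 is the same number l = V / I₂, where V is the volume of Ω and I₂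
is the least value of ∫|g|² over linear functionals g with g(X) = 1. On the other side,
`bergmanMetric_zero` gives B_p(0;X) = (I_p / V)^(-1/p), with I_p the least value of ∫|g|^p. The
theorem thus compares minimal normalized L² and L^p norms, and strict Jensen
(`average_norm_rpow_strict`) decides it; equality would make |g| constant on Ω, which is impossible
as g(0) = 0.

The value of the Levi form comes from the expansion V K_p(rX) = 1 + l r² + o(r²), since K_p is
constant on the circles |t| = r in the line through X. The lower bound (`one_add_le_bergmanKernel`)
tests the kernel on (1 + l r g)^(2/p), with g the minimizer for I₂.

The upper bound (`eventually_norm_rpow_le_exp`) is the main work. A function with ∫|f|^p = V and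
|f(rX)| ≥ 1 has |f(0)| near 1, hence |f| near 1 on a large compact circled K. There f has no zeros,
so f^(p/2) has a holomorphic branch on each slice and Bessel's inequality turns ∫|f|^p = V into a
bound on df(0) that costs |f(0)| to second order. Balancing this loss against the first-order gain
at rX yields exactly l r². -/

/-! ### Circle means of holomorphic functions of one variable -/

section OneVariable

open Complex Metric Real

/-- Sub-mean value property of `‖h‖ ^ p` for holomorphic `h` and every `p > 0`. -/
lemma norm_rpow_le_circleAverage {h : ℂ → ℂ} {p : ℝ} (hp : 0 < p)
    (hh : AnalyticOnNhd ℂ h (closedBall 0 1)) :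
    ‖h 0‖ ^ p ≤ circleAverage (fun z => ‖h z‖ ^ p) 0 1 := by
  have hnn : 0 ≤ circleAverage (fun z => ‖h z‖ ^ p) 0 1 :=
    circleAverage_nonneg_of_nonneg fun x _ => by positivity
  by_cases h0 : h 0 = 0
  · simpa [h0, Real.zero_rpow hp.ne'] using hnn
  have hsph : sphere (0 : ℂ) |1| ⊆ closedBall 0 1 := by
    simpa using sphere_subset_closedBall
  have hm : 0 < ‖h 0‖ := norm_pos_iff.mpr h0
  -- Jensen's formula: the zeros in the disc contribute nonnegative terms, so log|h| is sub-mean.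
  have hJ := AnalyticOnNhd.circleAverage_log_norm (R := 1) (c := 0) (f := h) one_ne_zero
    (by simpa using hh) h0
  have hJ' : Real.log ‖h 0‖ ≤ circleAverage (fun z => Real.log ‖h z‖) 0 1 := by
    rw [hJ, le_add_iff_nonneg_left]
    refine finsum_nonneg fun u => ?_
    by_cases hu : u ∈ closedBall (0 : ℂ) |1|
    · refine mul_nonneg ?_ ?_
      · have := MeromorphicOn.AnalyticOnNhd.divisor_nonneg
          (f := h) (U := closedBall 0 |1|) (by simpa using hh)
        exact_mod_cast this u
      · have hu' : ‖u‖ ≤ 1 := by simpa using hu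
        rcases eq_or_ne u 0 with rfl | hu0
        · simp
        · refine Real.log_nonneg ?_
          simpa using (one_le_inv₀ (norm_pos_iff.mpr hu0)).mpr hu'
    · rw [Function.locallyFinsuppWithin.apply_eq_zero_of_notMem _ hu]
      simp
  set m := ‖h 0‖ with hmdef
  -- The tangent line to t ↦ exp(pt) at log m, evaluated at log|h|; by convexity it lies below |h|^p
  -- off the zeros of h.
  let F₁ : ℂ → ℝ := fun z => m ^ p * (1 - p * Real.log m) + (m ^ p * p) * Real.log ‖h z‖
  have hne : {z | h z ≠ 0} ∈ codiscreteWithin (sphere (0 : ℂ) |1|) :=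
    codiscreteWithin_mono hsph (hh.preimage_zero_mem_codiscreteWithin (x := 0) h0 (by simp)
      ((convex_closedBall _ _).isConnected ⟨0, by simp⟩))
  have hlog : CircleIntegrable (fun z => Real.log ‖h z‖) 0 1 :=
    MeromorphicOn.circleIntegrable_log_norm fun z hz => (hh z (hsph hz)).meromorphicAt
  have hF₁ : CircleIntegrable F₁ 0 1 := by
    refine CircleIntegrable.add (circleIntegrable_const _ _ _) ?_
    exact hlog.const_fun_smul (a := m ^ p * p)
  have hF₂ : CircleIntegrable (fun z => ‖h z‖ ^ p) 0 1 := by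
    refine ContinuousOn.circleIntegrable zero_le_one ?_
    exact ((hh.continuousOn.mono (by simpa using hsph)).norm).rpow_const fun _ _ => Or.inr hp.le
  have hle : ∀ z, h z ≠ 0 → F₁ z ≤ ‖h z‖ ^ p := by
    intro z hz
    have hz' : 0 < ‖h z‖ := norm_pos_iff.mpr hz
    have h1 : ‖h z‖ ^ p = m ^ p * Real.exp (p * (Real.log ‖h z‖ - Real.log m)) := by
      rw [Real.rpow_def_of_pos hz', Real.rpow_def_of_pos hm, ← Real.exp_add]
      congr 1; ring
    rw [h1]
    have := Real.add_one_le_exp (p * (Real.log ‖h z‖ - Real.log m))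
    calc F₁ z = m ^ p * (p * (Real.log ‖h z‖ - Real.log m) + 1) := by simp only [F₁]; ring
      _ ≤ _ := by gcongr
  -- At a zero of h the convention `Real.log 0 = 0` can push F₁ above |h|^p. Taking the maximum
  -- repairs the inequality and changes nothing on a codiscrete set, so the average is unaffected.
  have hcongr : (fun z => ‖h z‖ ^ p) =ᶠ[codiscreteWithin (sphere (0 : ℂ) |1|)]
      fun z => max (F₁ z) (‖h z‖ ^ p) := by
    filter_upwards [hne] with z hz
    exact (max_eq_right (hle z hz)).symm
  rw [circleAverage_congr_codiscreteWithin hcongr one_ne_zero]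
  have h2 : circleAverage F₁ 0 1 ≤ circleAverage (fun z => max (F₁ z) (‖h z‖ ^ p)) 0 1 :=
    circleAverage_mono hF₁ (hF₂.congr_codiscreteWithin hcongr) fun z _ => le_max_left _ _
  refine le_trans ?_ h2
  have h3 : circleAverage F₁ 0 1 = m ^ p * (1 - p * Real.log m)
      + (m ^ p * p) * circleAverage (fun z => Real.log ‖h z‖) 0 1 := by
    have := circleAverage_fun_add (circleIntegrable_const (m ^ p * (1 - p * Real.log m)) 0 1)
      (hlog.const_fun_smul (a := m ^ p * p))
    rw [circleAverage_fun_smul, circleAverage_const] at this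
    exact this
  rw [h3]
  have : m ^ p * p * Real.log m ≤ m ^ p * p * circleAverage (fun z => Real.log ‖h z‖) 0 1 := by
    gcongr
  nlinarith

/-- For `h` vanishing at the origin, `‖h' 0‖ ^ p` is at most the circle mean of `‖h‖ ^ p`. -/
lemma norm_deriv_rpow_le_circleAverage {h : ℂ → ℂ} {p : ℝ} (hp : 0 < p) {U : Set ℂ}
    (hU : IsOpen U) (hsub : closedBall 0 1 ⊆ U) (hh : DifferentiableOn ℂ h U) (h0 : h 0 = 0) :
    ‖deriv h 0‖ ^ p ≤ circleAverage (fun z => ‖h z‖ ^ p) 0 1 := by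
  -- This is h(z)/z continued by h'(0) at the origin; on the unit circle it has the modulus of h.
  have hd : DifferentiableOn ℂ (dslope h 0) U :=
    (differentiableOn_dslope (hU.mem_nhds (hsub (by simp)))).mpr hh
  have := norm_rpow_le_circleAverage hp ((hd.analyticOnNhd hU).mono hsub)
  rw [dslope_same] at this
  refine this.trans_eq (circleAverage_congr_sphere fun z hz => ?_)
  have hz1 : ‖z‖ = 1 := by simpa using hz
  have hz0 : z ≠ 0 := by rintro rfl; simp at hz1
  simp [dslope_of_ne _ hz0, slope_def_field, h0, hz1]

/-- The first two Fourier coefficients of a holomorphic function satisfy Bessel's inequality. -/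
lemma norm_sq_add_norm_deriv_sq_le_circleAverage {G : ℂ → ℂ} {U : Set ℂ}
    (hU : IsOpen U) (hsub : closedBall 0 1 ⊆ U) (hG : DifferentiableOn ℂ G U) :
    ‖G 0‖ ^ 2 + ‖deriv G 0‖ ^ 2 ≤ circleAverage (fun z => ‖G z‖ ^ 2) 0 1 := by
  set a := G 0 with ha
  set b := deriv G 0 with hb
  have hd : DifferentiableOn ℂ (dslope G 0) U :=
    (differentiableOn_dslope (hU.mem_nhds (hsub (by simp)))).mpr hG
  -- With D = `dslope G 0`, |G - a| = |D| on the circle, whence |G|² - Re H = |D - b|² ≥ 0 there.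
  -- The mean value of H is H(0) = |a|² + |b|².
  let H : ℂ → ℂ := fun z => 2 * (starRingEnd ℂ a * G z + starRingEnd ℂ b * dslope G 0 z)
    - ((‖a‖ ^ 2 + ‖b‖ ^ 2 : ℝ) : ℂ)
  have hH : DifferentiableOn ℂ H U :=
    (((hG.const_mul _).add (hd.const_mul _)).const_mul _).sub_const _
  have hcl : closure (ball (0 : ℂ) |1|) ⊆ U := by
    rw [abs_one, closure_ball _ one_ne_zero]; exact hsub
  have hHavg : circleAverage H 0 1 = H 0 :=
    DiffContOnCl.circleAverage (hH.mono hcl).diffContOnCl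
  have hHcont : ContinuousOn H (sphere 0 1) :=
    hH.continuousOn.mono (sphere_subset_closedBall.trans hsub)
  have hHint : CircleIntegrable H 0 1 := hHcont.circleIntegrable zero_le_one
  have hre := Complex.reCLM.circleAverage_comp_comm hHint
  rw [hHavg] at hre
  have hH0 : Complex.reCLM (H 0) = ‖a‖ ^ 2 + ‖b‖ ^ 2 := by
    have h1 : H 0 = ((‖a‖ ^ 2 + ‖b‖ ^ 2 : ℝ) : ℂ) := by
      simp only [H, dslope_same, ← ha, ← hb]
      rw [Complex.conj_mul', Complex.conj_mul']
      push_cast; ring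
    rw [h1]; simp only [reCLM_apply, Complex.ofReal_re]
  rw [← hH0, ← hre]
  refine circleAverage_mono ?_ ?_ fun z hz => ?_
  · exact (Complex.reCLM.continuous.comp_continuousOn hHcont).circleIntegrable zero_le_one
  · exact ((hG.continuousOn.mono (sphere_subset_closedBall.trans hsub)).norm.pow 2).circleIntegrable
      zero_le_one
  · have hz1 : ‖z‖ = 1 := by simpa using hz
    have hz0 : z ≠ 0 := by rintro rfl; simp at hz1
    have hD : G z - a = z * dslope G 0 z := by
      rw [dslope_of_ne _ hz0, slope_def_field]; field_simp; simp [a, mul_comm]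
    have h1 : ‖G z - a‖ ^ 2 = ‖dslope G 0 z‖ ^ 2 := by rw [hD, norm_mul, hz1, one_mul]
    have h2 : 0 ≤ ‖dslope G 0 z - b‖ ^ 2 := by positivity
    simp only [Complex.sq_norm, Complex.normSq_apply, sub_re, sub_im] at h1 h2
    simp only [H, Function.comp_apply, reCLM_apply, sub_re, mul_re, add_re, conj_re, conj_im,
      ofReal_re, re_ofNat, im_ofNat, Complex.sq_norm, Complex.normSq_apply]
    nlinarith

/-- Sharp second-order lower bound for the circle mean of `‖h‖ ^ p`, `h` free of zeros. -/
lemma norm_rpow_mul_le_circleAverage_of_ne_zero {h : ℂ → ℂ} {p : ℝ} {U : Set ℂ}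
    (hU : IsOpen U) (hsub : closedBall 0 1 ⊆ U) (hh : DifferentiableOn ℂ h U)
    (hne : ∀ z ∈ closedBall 0 1, h z ≠ 0) :
    ‖h 0‖ ^ p * (1 + p ^ 2 / 4 * ‖deriv h 0 / h 0‖ ^ 2) ≤
      circleAverage (fun z => ‖h z‖ ^ p) 0 1 := by
  have hW : IsOpen (U ∩ h ⁻¹' {0}ᶜ) :=
    hh.continuousOn.isOpen_inter_preimage hU isOpen_compl_singleton
  obtain ⟨δ, hδ, hδW⟩ := (isCompact_closedBall (0 : ℂ) 1).exists_thickening_subset_open hW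
    fun z hz => ⟨hsub hz, hne z hz⟩
  rw [thickening_closedBall hδ zero_le_one] at hδW
  set R := δ + 1
  have hhR : DifferentiableOn ℂ h (ball 0 R) := hh.mono fun z hz => (hδW hz).1
  have hneR : ∀ z ∈ ball 0 R, h z ≠ 0 := fun z hz => (hδW hz).2
  have hsubR : closedBall (0 : ℂ) 1 ⊆ ball 0 R := closedBall_subset_ball (by simp [R, hδ])
  have h0R : (0 : ℂ) ∈ ball 0 R := hsubR (by simp)
  have hex : DifferentiableOn ℂ (fun z => deriv h z / h z) (ball 0 R) :=
    (hhR.deriv isOpen_ball).div hhR hneR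
  obtain ⟨φ, hφ0, hφ⟩ := hex.isExactOn_ball.with_val_at 0 0
  have hderiv : ∀ z ∈ ball 0 R, HasDerivAt (fun z => h z * Complex.exp (-φ z)) 0 z := by
    intro z hz
    have h1 := (hhR.differentiableAt (isOpen_ball.mem_nhds hz)).hasDerivAt
    have h2 := hneR z hz
    refine (h1.mul (hφ z hz).neg.cexp).congr_deriv ?_
    simp only [Pi.neg_apply]
    rw [show h z * (Complex.exp (-φ z) * -(deriv h z / h z))
      = -(deriv h z * Complex.exp (-φ z)) by field_simp]
    ring
  have hconst : ∀ z ∈ ball 0 R, h z = h 0 * Complex.exp (φ z) := by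
    intro z hz
    have h1 := (convex_ball (0 : ℂ) R).is_const_of_fderivWithin_eq_zero (𝕜 := ℂ)
      (f := fun z => h z * Complex.exp (-φ z))
      (fun z hz => (hderiv z hz).differentiableAt.differentiableWithinAt)
      (fun z hz => by
        rw [fderivWithin_of_isOpen isOpen_ball hz]
        ext; simp [(hderiv z hz).deriv]) hz h0R
    simp only [hφ0, neg_zero, Complex.exp_zero, mul_one] at h1
    rw [← h1, mul_assoc, ← Complex.exp_add]; simp
  -- A branch of (h / h(0))^(p/2): then |h|^p = |h(0)|^p |G|², and Bessel applies to G.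
  let G : ℂ → ℂ := fun z => Complex.exp (((p / 2 : ℝ) : ℂ) * φ z)
  have hGd : ∀ z ∈ ball 0 R, HasDerivAt G (G z * (((p / 2 : ℝ) : ℂ) * (deriv h z / h z))) z :=
    fun z hz => ((hφ z hz).const_mul _).cexp
  have hB := norm_sq_add_norm_deriv_sq_le_circleAverage isOpen_ball hsubR
    (fun z hz => (hGd z hz).differentiableAt.differentiableWithinAt)
  rw [(hGd 0 h0R).deriv] at hB
  have hG0 : G 0 = 1 := by simp [G, hφ0]
  rw [hG0] at hB
  have havg : circleAverage (fun z => ‖h z‖ ^ p) 0 1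
      = ‖h 0‖ ^ p * circleAverage (fun z => ‖G z‖ ^ 2) 0 1 := by
    rw [← smul_eq_mul, ← circleAverage_fun_smul]
    refine circleAverage_congr_sphere fun z hz => ?_
    have hz' : z ∈ ball 0 R := hsubR (sphere_subset_closedBall (by simpa using hz))
    simp only [smul_eq_mul]
    rw [hconst z hz', norm_mul, Real.mul_rpow (norm_nonneg _) (norm_nonneg _)]
    congr 1
    simp only [G, Complex.norm_exp]
    rw [← Real.exp_mul, ← Real.exp_nat_mul, Complex.re_ofReal_mul]
    congr 1; push_cast; ring
  rw [havg]
  gcongr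
  refine le_trans (le_of_eq ?_) hB
  rw [one_mul, norm_mul, norm_one, mul_pow, Complex.norm_real, Real.norm_eq_abs, sq_abs]
  ring

/-- A holomorphic function with almost maximal modulus at the centre of a disc is almost affine
near the centre. -/
lemma norm_le_of_norm_le_add {h : ℂ → ℂ} {δ μ : ℝ} (hδ : 0 < δ) (hμ : 0 < μ)
    (hh : DifferentiableOn ℂ h (ball 0 δ)) (hle : ∀ z ∈ ball 0 δ, ‖h z‖ ≤ ‖h 0‖ + μ)
    {z : ℂ} (hz : ‖z‖ < δ / 2) :
    ‖h z‖ ≤ ‖h 0‖ + ‖deriv h 0‖ * ‖z‖ + 16 * μ / δ ^ 2 * ‖z‖ ^ 2 := by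
  obtain ⟨c, hc, hch⟩ : ∃ c : ℂ, ‖c‖ = 1 ∧ c * h 0 = ‖h 0‖ := by
    by_cases h0 : h 0 = 0
    · exact ⟨1, by simp, by simp [h0]⟩
    · have : (‖h 0‖ : ℂ) ≠ 0 := by simpa using h0
      exact ⟨‖h 0‖ / h 0, by simp [h0], by field_simp⟩
  -- After rotating h(0) to the positive axis, Re u ≤ μ, so Borel–Carathéodory bounds |u| by 2μ on
  -- the half disc.
  let u : ℂ → ℂ := fun z => c * h z - ‖h 0‖
  have hu : DifferentiableOn ℂ u (ball 0 δ) := (hh.const_mul c).sub_const _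
  have hu0 : u 0 = 0 := by simp [u, hch]
  have hub : ∀ z ∈ ball (0 : ℂ) (δ / 2), ‖u z‖ ≤ 2 * μ := by
    intro z hz
    have hzn : ‖z‖ < δ / 2 := by simpa using hz
    have h1 := borelCaratheodory_zero hμ hu (fun w hw => by
      have h2 := hle w hw
      have h3 := Complex.re_le_norm (c * h w)
      rw [norm_mul, hc, one_mul] at h3
      simp only [u, Set.mem_ofPred_eq, sub_re, ofReal_re]
      linarith) hδ (z := z) (by simp; linarith) hu0
    refine h1.trans ?_
    rw [div_le_iff₀ (by linarith)]
    nlinarith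
  have hu2 : DifferentiableOn ℂ u (ball 0 (δ / 2)) := hu.mono (ball_subset_ball (by linarith))
  have hd0 : ‖deriv u 0‖ ≤ 2 * μ / (δ / 2) := by
    refine norm_deriv_le_div_of_mapsTo_ball hu2 (fun w hw => ?_) (by positivity)
    simpa [hu0] using hub w hw
  have hdiff0 : DifferentiableAt ℂ u 0 := hu.differentiableAt (ball_mem_nhds _ hδ)
  have hdu : deriv u 0 = c * deriv h 0 := by
    have := hh.differentiableAt (ball_mem_nhds (0 : ℂ) hδ)
    simp [u, this]
  -- Removing the linear term leaves |v| ≤ 4μ with a double zero; the Schwarz lemma of second order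
  -- on radius δ/2 gives the factor 16μ/δ².
  let v : ℂ → ℂ := fun z => u z - deriv u 0 * z
  have hv : DifferentiableOn ℂ v (ball 0 (δ / 2)) :=
    hu2.sub (differentiableOn_id.const_mul _)
  have hv0 : v 0 = 0 := by simp [v, hu0]
  have hvle := dist_le_mul_div_pow_of_mapsTo_ball_of_isLittleO (n := 1) (z := z) (R₂ := 4 * μ) hv
    (fun w hw => by
      have hwn : ‖w‖ < δ / 2 := by simpa using hw
      have h1 : ‖deriv u 0 * w‖ ≤ 2 * μ := by
        rw [norm_mul]
        calc ‖deriv u 0‖ * ‖w‖ ≤ 2 * μ / (δ / 2) * (δ / 2) := by gcongr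
          _ = 2 * μ := by field_simp
      have h2 := norm_sub_le (u w) (deriv u 0 * w)
      have h3 := hub w hw
      simp only [hv0, mem_closedBall, dist_zero_right, v]
      linarith)
    (by
      have := hdiff0.hasDerivAt.isLittleO
      simp only [hu0, sub_zero, smul_eq_mul] at this
      simpa [v, hu0, mul_comm] using this.norm_right)
    (by simpa using hz)
  simp only [hv0, dist_zero_right] at hvle
  have hcz : c * h z = ‖h 0‖ + deriv u 0 * z + v z := by simp [v, u]
  calc ‖h z‖ = ‖c * h z‖ := by rw [norm_mul, hc, one_mul]
    _ ≤ ‖(‖h 0‖ : ℂ)‖ + ‖deriv u 0 * z‖ + ‖v z‖ := by rw [hcz]; exact norm_add₃_le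
    _ ≤ ‖h 0‖ + ‖deriv h 0‖ * ‖z‖ + 16 * μ / δ ^ 2 * ‖z‖ ^ 2 := by
      rw [hdu, norm_mul, norm_mul, hc, one_mul]
      refine add_le_add (by simp) (hvle.trans_eq ?_)
      rw [one_add_one_eq_two, div_pow, div_pow]
      field_simp; ring

end OneVariable

/-! ### Rotation averaging on circled sets -/

section Circled

open Metric Real

variable {n : ℕ}

/-- Rotations `z ↦ c z` with `|c| = 1` preserve Lebesgue measure on `ℂⁿ`. -/
lemma measurePreserving_rotation {c : ℂ} (hc : ‖c‖ = 1) :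
    MeasurePreserving (fun z : Fin n → ℂ => c • z) volume volume := by
  have h1 : MeasurePreserving (fun z : ℂ => c * z) volume volume :=
    (rotation ⟨c, by simpa [Submonoid.unitSphere, mem_sphere_zero_iff_norm] using hc⟩).measurePreserving
  exact volume_preserving_pi (fun _ : Fin n => h1)

lemma preimage_rotation_eq {S : Set (Fin n → ℂ)} (hS : ∀ z ∈ S, ∀ t : ℂ, ‖t‖ ≤ 1 → t • z ∈ S)
    {c : ℂ} (hc : ‖c‖ = 1) : (fun z : Fin n → ℂ => c • z) ⁻¹' S = S := by
  have hc0 : c ≠ 0 := by rintro rfl; simp at hc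
  ext z
  refine ⟨fun h => ?_, fun h => hS z h c hc.le⟩
  have := hS _ h c⁻¹ (by simp [hc])
  simpa [smul_smul, hc0] using this

lemma measurePreserving_rotation_restrict {S : Set (Fin n → ℂ)} (hSm : MeasurableSet S)
    (hS : ∀ z ∈ S, ∀ t : ℂ, ‖t‖ ≤ 1 → t • z ∈ S) {c : ℂ} (hc : ‖c‖ = 1) :
    MeasurePreserving (fun z : Fin n → ℂ => c • z) (volume.restrict S) (volume.restrict S) := by
  have := (measurePreserving_rotation (n := n) hc).restrict_preimage hSm
  rwa [preimage_rotation_eq hS hc] at this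

lemma setIntegral_comp_rotation {S : Set (Fin n → ℂ)} (hSm : MeasurableSet S)
    (hS : ∀ z ∈ S, ∀ t : ℂ, ‖t‖ ≤ 1 → t • z ∈ S) {c : ℂ} (hc : ‖c‖ = 1)
    {E : Type*} [NormedAddCommGroup E] [NormedSpace ℝ E] (F : (Fin n → ℂ) → E) :
    ∫ z in S, F (c • z) = ∫ z in S, F z := by
  have hc0 : c ≠ 0 := by rintro rfl; simp at hc
  exact (measurePreserving_rotation_restrict hSm hS hc).integral_comp
    (Homeomorph.smulOfNeZero c hc0).measurableEmbedding F

/-- The integral over a circled set dominates the integral of any minorant of the circle means. -/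
lemma setIntegral_le_of_le_circleAverage {S : Set (Fin n → ℂ)} (hSm : MeasurableSet S)
    (hS : ∀ z ∈ S, ∀ t : ℂ, ‖t‖ ≤ 1 → t • z ∈ S) {F φ : (Fin n → ℂ) → ℝ}
    (hF : IntegrableOn F S) (hφ : IntegrableOn φ S)
    (hle : ∀ z ∈ S, φ z ≤ circleAverage (fun t : ℂ => F (t • z)) 0 1) :
    ∫ z in S, φ z ≤ ∫ z in S, F z := by
  let μ : Measure ℝ := volume.restrict (Set.Ioc 0 (2 * π))
  let ν : Measure (Fin n → ℂ) := volume.restrict S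
  -- Twisting each fibre by its rotation preserves the product measure, so integrability for Fubini
  -- follows from that of F alone.
  have hmp : MeasurePreserving (fun q : ℝ × (Fin n → ℂ) => (q.1, circleMap 0 1 q.1 • q.2))
      (μ.prod ν) (μ.prod ν) := by
    refine (MeasurePreserving.id μ).skew_product (g := fun θ z => circleMap 0 1 θ • z) ?_ ?_
    · have : Continuous fun q : ℝ × (Fin n → ℂ) => circleMap 0 1 q.1 • q.2 :=
        ((continuous_circleMap 0 1).comp continuous_fst).smul continuous_snd
      exact this.measurable
    · exact ae_of_all _ fun θ => (measurePreserving_rotation_restrict hSm hS (by simp)).map_eq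
  have h0 : Integrable (fun q : ℝ × (Fin n → ℂ) => F q.2) (μ.prod ν) := hF.comp_snd μ
  have hH : Integrable (fun q : ℝ × (Fin n → ℂ) => F (circleMap 0 1 q.1 • q.2)) (μ.prod ν) :=
    hmp.integrable_comp_of_integrable h0
  have hswap := integral_integral_swap (μ := μ) (ν := ν)
    (f := fun θ z => F (circleMap 0 1 θ • z)) hH
  have hleft : ∀ θ, ∫ z, F (circleMap 0 1 θ • z) ∂ν = ∫ z, F z ∂ν := fun θ =>
    setIntegral_comp_rotation hSm hS (by simp) F
  simp only [hleft] at hswap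
  have hμ : ∫ _θ, (∫ z, F z ∂ν) ∂μ = 2 * π * ∫ z in S, F z := by
    simp [μ, ν, Real.pi_pos.le]
  rw [hμ] at hswap
  have havg : ∀ z, circleAverage (fun t : ℂ => F (t • z)) 0 1
      = (2 * π)⁻¹ * ∫ θ, F (circleMap 0 1 θ • z) ∂μ := by
    intro z
    rw [circleAverage, intervalIntegral.integral_of_le (by positivity), smul_eq_mul]
  calc ∫ z in S, φ z ≤ ∫ z in S, (2 * π)⁻¹ * ∫ θ, F (circleMap 0 1 θ • z) ∂μ := by
        refine setIntegral_mono_on hφ ?_ hSm fun z hz => (hle z hz).trans_eq (havg z)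
        exact hH.integral_prod_right.const_mul _
    _ = ∫ z in S, F z := by
        rw [integral_const_mul, ← hswap]
        field_simp

section Slice

variable {S : Set (Fin n → ℂ)} {f : (Fin n → ℂ) → ℂ}

lemma isOpen_slice (hSo : IsOpen S) (z : Fin n → ℂ) : IsOpen {t : ℂ | t • z ∈ S} :=
  hSo.preimage (by fun_prop)

lemma differentiableOn_slice (hf : DifferentiableOn ℂ f S) (z : Fin n → ℂ) :
    DifferentiableOn ℂ (fun t : ℂ => f (t • z)) {t : ℂ | t • z ∈ S} :=
  hf.comp (by fun_prop) fun _ ht => ht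

lemma deriv_slice (hSo : IsOpen S) (h0 : (0 : Fin n → ℂ) ∈ S) (hf : DifferentiableOn ℂ f S)
    (z : Fin n → ℂ) : deriv (fun t : ℂ => f (t • z)) 0 = fderiv ℂ f 0 z := by
  have h1 : HasFDerivAt f (fderiv ℂ f 0) ((0 : ℂ) • z) := by
    rw [zero_smul]; exact (hf.differentiableAt (hSo.mem_nhds h0)).hasFDerivAt
  have h2 : HasDerivAt (fun t : ℂ => t • z) z 0 := by
    simpa using (hasDerivAt_id (0 : ℂ)).smul_const z
  exact (h1.comp_hasDerivAt 0 h2).deriv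

end Slice

/-- Point evaluation at the centre of a circled open set. -/
lemma measureReal_mul_norm_rpow_le {S : Set (Fin n → ℂ)} (hSo : IsOpen S)
    (hS : ∀ z ∈ S, ∀ t : ℂ, ‖t‖ ≤ 1 → t • z ∈ S) (hfin : volume S ≠ ⊤) {p : ℝ} (hp : 0 < p)
    {f : (Fin n → ℂ) → ℂ} (hf : MemBergman p S f) :
    volume.real S * ‖f 0‖ ^ p ≤ ∫ z in S, ‖f z‖ ^ p := by
  have := setIntegral_le_of_le_circleAverage hSo.measurableSet hS hf.2
    (φ := fun _ => ‖f 0‖ ^ p) (integrableOn_const hfin) fun z hz => by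
      have h1 := ((differentiableOn_slice hf.1 z).analyticOnNhd (isOpen_slice hSo z)).mono
        (s := closedBall 0 1) fun t ht => hS z hz t (by simpa using ht)
      simpa using norm_rpow_le_circleAverage hp h1
  simpa using this

/-- The linear part of a function vanishing at the centre has smaller `p`-norm. -/
lemma setIntegral_fderiv_rpow_le {S : Set (Fin n → ℂ)} (hSo : IsOpen S) (h0 : 0 ∈ S)
    (hS : ∀ z ∈ S, ∀ t : ℂ, ‖t‖ ≤ 1 → t • z ∈ S) {p : ℝ} (hp : 0 < p)
    {f : (Fin n → ℂ) → ℂ} (hf : MemBergman p S f) (hf0 : f 0 = 0)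
    (hint : IntegrableOn (fun z => ‖fderiv ℂ f 0 z‖ ^ p) S) :
    ∫ z in S, ‖fderiv ℂ f 0 z‖ ^ p ≤ ∫ z in S, ‖f z‖ ^ p := by
  refine setIntegral_le_of_le_circleAverage hSo.measurableSet hS hf.2 hint fun z hz => ?_
  rw [← deriv_slice hSo h0 hf.1 z]
  exact norm_deriv_rpow_le_circleAverage hp (isOpen_slice hSo z)
    (fun t ht => hS z hz t (by simpa using ht)) (differentiableOn_slice hf.1 z) (by simpa using hf0)

/-- Point evaluations on the `p`-Bergman space are bounded. -/
lemma norm_rpow_le_of_ball_subset {Ω : Set (Fin n → ℂ)} {p : ℝ} (hp : 0 < p)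
    {f : (Fin n → ℂ) → ℂ} (hf : MemBergman p Ω f) {z : Fin n → ℂ} {δ : ℝ}
    (hball : ball z δ ⊆ Ω) :
    volume.real (ball (0 : Fin n → ℂ) δ) * ‖f z‖ ^ p ≤ ∫ w in Ω, ‖f w‖ ^ p := by
  have hmp : MeasurePreserving (fun w : Fin n → ℂ => z + w) volume volume :=
    measurePreserving_add_left volume z
  have hemb : MeasurableEmbedding (fun w : Fin n → ℂ => z + w) :=
    (Homeomorph.addLeft z).measurableEmbedding
  have hpre : (fun w : Fin n → ℂ => z + w) ⁻¹' ball z δ = ball 0 δ := by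
    ext w; simp [dist_eq_norm]
  have hint : IntegrableOn (fun w => ‖f w‖ ^ p) (ball z δ) := hf.2.mono_set hball
  have hf' : MemBergman p (ball 0 δ) (fun w => f (z + w)) := by
    refine ⟨(hf.1.mono hball).comp (by fun_prop) fun w hw => ?_, ?_⟩
    · rw [← hpre] at hw; exact hw
    · have := (hmp.integrableOn_comp_preimage hemb (s := ball z δ)).mpr hint
      rwa [hpre] at this
  have h1 := measureReal_mul_norm_rpow_le isOpen_ball (fun w hw t ht => ?_)
    measure_ball_lt_top.ne hp hf'
  · have h2 := hmp.setIntegral_preimage_emb hemb (fun w => ‖f w‖ ^ p) (ball z δ)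
    rw [hpre] at h2
    rw [h2, add_zero] at h1
    exact h1.trans (setIntegral_mono_set hf.2 (ae_of_all _ fun w => by positivity)
      (LE.le.eventuallyLE hball))
  · rw [mem_ball_zero_iff] at hw ⊢
    rw [norm_smul]
    calc ‖t‖ * ‖w‖ ≤ 1 * ‖w‖ := by gcongr
      _ < δ := by simpa using hw

end Circled

/-! ### Extremal linear functionals and their L^q norms -/

section LinearFunctionals

open Metric Real

variable {n : ℕ} {Ω : Set (Fin n → ℂ)}

lemma integrableOn_norm_rpow_of_continuous (hbdd : Bornology.IsBounded Ω) {f : (Fin n → ℂ) → ℂ}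
    (hf : Continuous f) {q : ℝ} (hq : 0 < q) : IntegrableOn (fun z => ‖f z‖ ^ q) Ω := by
  have : Continuous fun z => ‖f z‖ ^ q := hf.norm.rpow_const fun _ => Or.inr hq.le
  exact (this.continuousOn.integrableOn_compact hbdd.isCompact_closure).mono_set subset_closure

lemma eq_zero_of_forall_mem_nhds {s : Set (Fin n → ℂ)} (hs : s ∈ 𝓝 0)
    {g : (Fin n → ℂ) →L[ℂ] ℂ} (hg : ∀ z ∈ s, g z = 0) : g = 0 := by
  have h1 : (g : (Fin n → ℂ) → ℂ) =ᶠ[𝓝 0] fun _ => 0 := by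
    filter_upwards [hs] with z hz using hg z hz
  have h2 := h1.fderiv_eq (𝕜 := ℂ)
  simpa using h2

lemma setIntegral_norm_rpow_pos (hopen : IsOpen Ω) (h0 : 0 ∈ Ω) (hbdd : Bornology.IsBounded Ω)
    {q : ℝ} (hq : 0 < q) {g : (Fin n → ℂ) →L[ℂ] ℂ} (hg : g ≠ 0) : 0 < ∫ z in Ω, ‖g z‖ ^ q := by
  refine lt_of_le_of_ne (integral_nonneg fun z => by positivity) fun h => hg ?_
  have hi := integrableOn_norm_rpow_of_continuous hbdd g.continuous hq
  have h1 := (integral_eq_zero_iff_of_nonneg (fun z => by positivity) hi).mp h.symm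
  have h2 := Measure.eqOn_open_of_ae_eq h1 hopen
    (g.continuous.norm.rpow_const fun _ => Or.inr hq.le).continuousOn continuousOn_const
  refine eq_zero_of_forall_mem_nhds (hopen.mem_nhds h0) fun z hz => ?_
  have h3 : ‖g z‖ ^ q = 0 := h2 hz
  rw [Real.rpow_eq_zero (norm_nonneg _) hq.ne'] at h3
  simpa using h3

lemma continuous_setIntegral_norm_rpow (hopen : IsOpen Ω) (hbdd : Bornology.IsBounded Ω)
    {q : ℝ} (hq : 0 < q) :
    Continuous fun g : (Fin n → ℂ) →L[ℂ] ℂ => ∫ z in Ω, ‖g z‖ ^ q := by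
  obtain ⟨R, hR⟩ := hbdd.exists_norm_le
  have hfin : volume Ω ≠ ⊤ := hbdd.measure_lt_top.ne
  have : IsFiniteMeasure (volume.restrict Ω) := isFiniteMeasure_restrict.mpr hfin
  refine continuous_iff_continuousAt.mpr fun g₀ => ?_
  refine continuousAt_of_dominated (bound := fun _ => ((‖g₀‖ + 1) * R) ^ q) ?_ ?_
    (integrable_const _) ?_
  · exact Eventually.of_forall fun g =>
      (g.continuous.norm.rpow_const fun _ => Or.inr hq.le).aestronglyMeasurable
  · filter_upwards [ball_mem_nhds g₀ one_pos] with g hg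
    filter_upwards [ae_restrict_mem hopen.measurableSet] with z hz
    rw [Real.norm_of_nonneg (by positivity)]
    have h1 : ‖g‖ ≤ ‖g₀‖ + 1 := by
      have := norm_le_norm_add_norm_sub' g g₀
      rw [mem_ball, dist_eq_norm] at hg
      linarith
    refine Real.rpow_le_rpow (norm_nonneg _) ((g.le_opNorm z).trans ?_) hq.le
    exact mul_le_mul h1 (hR z hz) (norm_nonneg _) (by positivity)
  · refine ae_of_all _ fun z => ?_
    have : Continuous fun g : (Fin n → ℂ) →L[ℂ] ℂ => g z :=
      (ContinuousLinearMap.apply ℂ ℂ z).continuous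
    exact (this.norm.rpow_const fun _ => Or.inr hq.le).continuousAt

/-- The extremal linear functional for the `q`-norm on `Ω`, normalized to be `1` at `X`. -/
lemma exists_minimal_functional (hopen : IsOpen Ω) (h0 : 0 ∈ Ω) (hbdd : Bornology.IsBounded Ω)
    {q : ℝ} (hq : 0 < q) {X : Fin n → ℂ} (hX : X ≠ 0) :
    ∃ g₀ : (Fin n → ℂ) →L[ℂ] ℂ, g₀ X = 1 ∧ ∀ g : (Fin n → ℂ) →L[ℂ] ℂ,
      ‖g X‖ ^ q * ∫ z in Ω, ‖g₀ z‖ ^ q ≤ ∫ z in Ω, ‖g z‖ ^ q := by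
  have hhom : ∀ (c : ℂ) (g : (Fin n → ℂ) →L[ℂ] ℂ),
      ∫ z in Ω, ‖(c • g) z‖ ^ q = ‖c‖ ^ q * ∫ z in Ω, ‖g z‖ ^ q := by
    intro c g
    rw [← integral_const_mul]
    congr with z
    rw [smul_apply, smul_eq_mul, norm_mul,
      Real.mul_rpow (norm_nonneg _) (norm_nonneg _)]
  obtain ⟨e, he⟩ : ∃ e : (Fin n → ℂ) →L[ℂ] ℂ, e X ≠ 0 := by
    obtain ⟨i, hi⟩ := Function.ne_iff.mp hX
    exact ⟨ContinuousLinearMap.proj i, hi⟩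
  -- A ratio of degree 0 in g, so it may be maximized on the compact unit sphere. No convexity
  -- enters, which admits q < 1.
  let ψ : ((Fin n → ℂ) →L[ℂ] ℂ) → ℝ := fun g => ‖g X‖ ^ q / ∫ z in Ω, ‖g z‖ ^ q
  have hcont : ContinuousOn ψ (sphere 0 1) := by
    refine ContinuousOn.div ?_ (continuous_setIntegral_norm_rpow hopen hbdd hq).continuousOn ?_
    · have : Continuous fun g : (Fin n → ℂ) →L[ℂ] ℂ => g X :=
        (ContinuousLinearMap.apply ℂ ℂ X).continuous
      exact (this.norm.rpow_const fun _ => Or.inr hq.le).continuousOn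
    · intro g hg
      refine (setIntegral_norm_rpow_pos hopen h0 hbdd hq ?_).ne'
      rintro rfl
      simp at hg
  have hscale : ∀ (c : ℂ) (g : (Fin n → ℂ) →L[ℂ] ℂ), c ≠ 0 → ψ (c • g) = ψ g := by
    intro c g hc
    have : 0 < ‖c‖ ^ q := Real.rpow_pos_of_pos (norm_pos_iff.mpr hc) q
    simp only [ψ, hhom]
    rw [smul_apply, smul_eq_mul, norm_mul,
      Real.mul_rpow (norm_nonneg _) (norm_nonneg _), mul_div_mul_left _ _ this.ne']
  have he0 : e ≠ 0 := by rintro rfl; simp at he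
  have hmem : ∀ g : (Fin n → ℂ) →L[ℂ] ℂ, g ≠ 0 → ((‖g‖⁻¹ : ℝ) : ℂ) • g ∈ sphere 0 1 := by
    intro g hg
    have : ‖g‖ ≠ 0 := norm_ne_zero_iff.mpr hg
    rw [mem_sphere_zero_iff_norm, norm_smul]
    simp [this]
  have hc0 : ∀ g : (Fin n → ℂ) →L[ℂ] ℂ, g ≠ 0 → ((‖g‖⁻¹ : ℝ) : ℂ) ≠ 0 := by
    intro g hg; simpa using hg
  obtain ⟨g₁, hg₁, hmax⟩ := (isCompact_sphere _ _).exists_isMaxOn ⟨_, hmem e he0⟩ hcont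
  have hle : ∀ g : (Fin n → ℂ) →L[ℂ] ℂ, g ≠ 0 → ψ g ≤ ψ g₁ := fun g hg => by
    rw [← hscale _ g (hc0 g hg)]; exact hmax (hmem g hg)
  have hψe : 0 < ψ e := div_pos (Real.rpow_pos_of_pos (norm_pos_iff.mpr he) q)
    (setIntegral_norm_rpow_pos hopen h0 hbdd hq he0)
  have hg₁X : g₁ X ≠ 0 := by
    intro h
    have := hle e he0
    simp only [ψ, h, norm_zero, Real.zero_rpow hq.ne', zero_div] at this
    exact this.not_gt hψe
  refine ⟨(g₁ X)⁻¹ • g₁, by simp [hg₁X], fun g => ?_⟩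
  rcases eq_or_ne g 0 with rfl | hg
  · simp [Real.zero_rpow hq.ne']
  have h1 := hle g hg
  rw [← hscale (g₁ X)⁻¹ g₁ (inv_ne_zero hg₁X)] at h1
  have h2 : (g₁ X)⁻¹ • g₁ ≠ 0 := fun h => by
    have := congrArg (fun g => g X) h
    simp [hg₁X] at this
  have h3 := setIntegral_norm_rpow_pos hopen h0 hbdd hq h2
  have h4 := setIntegral_norm_rpow_pos hopen h0 hbdd hq hg
  simp only [ψ] at h1
  rw [div_le_div_iff₀ h4 h3] at h1
  refine h1.trans_eq ?_
  simp [hg₁X]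

/-- Strict monotonicity of the normalized `L^q`-norms of a nonzero linear functional. -/
lemma average_norm_rpow_strict (hopen : IsOpen Ω) (h0 : 0 ∈ Ω) (hbdd : Bornology.IsBounded Ω)
    {q r : ℝ} (hq : 0 < q) (hqr : q < r) {g : (Fin n → ℂ) →L[ℂ] ℂ} (hg : g ≠ 0) :
    ((∫ z in Ω, ‖g z‖ ^ q) / volume.real Ω) ^ (1 / q)
      < ((∫ z in Ω, ‖g z‖ ^ r) / volume.real Ω) ^ (1 / r) := by
  have hr : 0 < r := hq.trans hqr
  have hfin : volume Ω ≠ ⊤ := hbdd.measure_lt_top.ne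
  have : IsFiniteMeasure (volume.restrict Ω) := isFiniteMeasure_restrict.mpr hfin
  have hconv : StrictConvexOn ℝ (Set.Ici 0) fun x : ℝ => x ^ (r / q) :=
    strictConvexOn_rpow ((one_lt_div hq).mpr hqr)
  have hcomp : ∀ z, (‖g z‖ ^ q) ^ (r / q) = ‖g z‖ ^ r := fun z => by
    rw [← Real.rpow_mul (norm_nonneg _), mul_div_cancel₀ _ hq.ne']
  have hgi := integrableOn_norm_rpow_of_continuous hbdd g.continuous hr
  have hfi := integrableOn_norm_rpow_of_continuous hbdd g.continuous hq
  have hJ := hconv.ae_eq_const_or_map_average_lt (μ := volume.restrict Ω)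
    (f := fun z => ‖g z‖ ^ q) (Real.continuous_rpow_const (by positivity)).continuousOn isClosed_Ici
    (ae_of_all _ fun z => by simp only [Set.mem_Ici]; positivity) hfi
    (by
      simp only [Function.comp_def, hcomp]
      exact hgi)
  have hIq := setIntegral_norm_rpow_pos hopen h0 hbdd hq hg
  have hIr := setIntegral_norm_rpow_pos hopen h0 hbdd hr hg
  have hV : 0 < volume.real Ω :=
    ENNReal.toReal_pos (hopen.measure_pos volume ⟨0, h0⟩).ne' hfin
  rcases hJ with hJ | hJ
  -- Equality in Jensen makes |g|^q constant on Ω by continuity, with the value 0 taken at the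
  -- origin.
  · exfalso
    have h2 := Measure.eqOn_open_of_ae_eq hJ hopen
      (g.continuous.norm.rpow_const fun _ => Or.inr hq.le).continuousOn continuousOn_const
    refine hg (eq_zero_of_forall_mem_nhds (hopen.mem_nhds h0) fun z hz => ?_)
    have h3 := (h2 hz).trans (h2 h0).symm
    simp only [map_zero, norm_zero, Real.zero_rpow hq.ne'] at h3
    rw [Real.rpow_eq_zero (norm_nonneg _) hq.ne'] at h3
    simpa using h3
  · simp only [hcomp, average_eq, measureReal_restrict_apply_univ, smul_eq_mul] at hJ
    rw [← div_eq_inv_mul, ← div_eq_inv_mul] at hJ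
    have h1 : ((∫ z in Ω, ‖g z‖ ^ q) / volume.real Ω) ^ (1 / q)
        = (((∫ z in Ω, ‖g z‖ ^ q) / volume.real Ω) ^ (r / q)) ^ (1 / r) := by
      rw [← Real.rpow_mul (by positivity)]
      congr 1; field_simp
    rw [h1]
    exact Real.rpow_lt_rpow (by positivity) hJ (by positivity)

end LinearFunctionals

/-! ### The kernel and metric at the centre, and the lower bound nearby -/

section Kernel

open Metric Real

variable {n : ℕ} {Ω : Set (Fin n → ℂ)} {p : ℝ}

lemma bergmanNorm_rpow (hp : 0 < p) (f : (Fin n → ℂ) → ℂ) :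
    bergmanNorm p Ω f ^ p = ∫ z in Ω, ‖f z‖ ^ p := by
  rw [bergmanNorm, ← Real.rpow_mul (integral_nonneg fun z => by positivity),
    one_div_mul_cancel hp.ne', Real.rpow_one]

lemma bergmanKernel_le (hp : 0 < p) {z : Fin n → ℂ} {C : ℝ} (hC : 0 ≤ C)
    (h : ∀ f, MemBergman p Ω f → ‖f z‖ ^ p ≤ C * ∫ w in Ω, ‖f w‖ ^ p) :
    bergmanKernel p Ω z ≤ C := by
  refine Real.sSup_le ?_ hC
  rintro t ⟨f, hf, -, rfl⟩
  rw [bergmanNorm_rpow hp]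
  exact div_le_of_le_mul₀ (integral_nonneg fun z => by positivity) hC (h f hf)

/-- Keeps the `sSup` defining the kernel genuine, since an unbounded set would give 0; it also
forces functions of zero norm to vanish at z. -/
lemma exists_norm_rpow_le (hopen : IsOpen Ω) (hp : 0 < p) {z : Fin n → ℂ} (hz : z ∈ Ω) :
    ∃ C, 0 < C ∧ ∀ f, MemBergman p Ω f → ‖f z‖ ^ p ≤ C * ∫ w in Ω, ‖f w‖ ^ p := by
  obtain ⟨δ, hδ, hball⟩ := Metric.isOpen_iff.mp hopen z hz
  have hV : 0 < volume.real (ball (0 : Fin n → ℂ) δ) :=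
    ENNReal.toReal_pos (measure_ball_pos volume _ hδ).ne' measure_ball_lt_top.ne
  refine ⟨(volume.real (ball (0 : Fin n → ℂ) δ))⁻¹, inv_pos.mpr hV, fun f hf => ?_⟩
  rw [← div_eq_inv_mul, le_div_iff₀ hV, mul_comm]
  exact norm_rpow_le_of_ball_subset hp hf hball

lemma le_bergmanKernel (hopen : IsOpen Ω) (hp : 0 < p) {z : Fin n → ℂ} (hz : z ∈ Ω)
    {f : (Fin n → ℂ) → ℂ} (hf : MemBergman p Ω f) (hf0 : ∃ w ∈ Ω, f w ≠ 0) :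
    ‖f z‖ ^ p / ∫ w in Ω, ‖f w‖ ^ p ≤ bergmanKernel p Ω z := by
  rw [← bergmanNorm_rpow hp]
  refine le_csSup ?_ ⟨f, hf, hf0, rfl⟩
  obtain ⟨C, hC, h⟩ := exists_norm_rpow_le hopen hp hz
  refine ⟨C, ?_⟩
  rintro t ⟨f, hf, -, rfl⟩
  rw [bergmanNorm_rpow hp]
  exact div_le_of_le_mul₀ (integral_nonneg fun z => by positivity) hC.le (h f hf)

lemma memBergman_comp_rotation (hopen : IsOpen Ω)
    (hcirc : ∀ z ∈ Ω, ∀ t : ℂ, ‖t‖ ≤ 1 → t • z ∈ Ω) {c : ℂ} (hc : ‖c‖ = 1)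
    {f : (Fin n → ℂ) → ℂ} (hf : MemBergman p Ω f) : MemBergman p Ω fun z => f (c • z) :=
  ⟨hf.1.comp (by fun_prop) fun z hz => hcirc z hz c hc.le,
    (measurePreserving_rotation_restrict hopen.measurableSet hcirc hc).integrable_comp_of_integrable
      hf.2⟩

/-- Composition with a rotation is an isometry of A^p(Ω). This reduces every circle average of log
K_p around 0 to a single value. -/
lemma bergmanKernel_rotation (hopen : IsOpen Ω)
    (hcirc : ∀ z ∈ Ω, ∀ t : ℂ, ‖t‖ ≤ 1 → t • z ∈ Ω) (hp : 0 < p) {c : ℂ} (hc : ‖c‖ = 1)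
    (z : Fin n → ℂ) : bergmanKernel p Ω (c • z) = bergmanKernel p Ω z := by
  have hsub : ∀ {c : ℂ} (_ : ‖c‖ = 1) (z : Fin n → ℂ),
      {t : ℝ | ∃ f : (Fin n → ℂ) → ℂ, MemBergman p Ω f ∧ (∃ w ∈ Ω, f w ≠ 0) ∧
        t = ‖f (c • z)‖ ^ p / bergmanNorm p Ω f ^ p} ⊆
      {t : ℝ | ∃ f : (Fin n → ℂ) → ℂ, MemBergman p Ω f ∧ (∃ w ∈ Ω, f w ≠ 0) ∧
        t = ‖f z‖ ^ p / bergmanNorm p Ω f ^ p} := by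
    rintro c hc z t ⟨f, hf, ⟨w, hw, hfw⟩, rfl⟩
    have hc0 : c ≠ 0 := by rintro rfl; simp at hc
    refine ⟨fun z => f (c • z), memBergman_comp_rotation hopen hcirc hc hf,
      ⟨c⁻¹ • w, hcirc w hw _ (by simp [hc]), by simpa [smul_smul, hc0] using hfw⟩, ?_⟩
    rw [bergmanNorm_rpow hp, bergmanNorm_rpow hp,
      setIntegral_comp_rotation hopen.measurableSet hcirc hc fun z => ‖f z‖ ^ p]
  have hc0 : c ≠ 0 := by rintro rfl; simp at hc
  refine congrArg sSup (Set.Subset.antisymm (hsub hc z) ?_)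
  have := hsub (c := c⁻¹) (by simp [hc]) (c • z)
  simpa [smul_smul, hc0] using this

lemma measureReal_pos_of_isOpen (hopen : IsOpen Ω) (h0 : 0 ∈ Ω) (hbdd : Bornology.IsBounded Ω) :
    0 < volume.real Ω :=
  ENNReal.toReal_pos (hopen.measure_pos volume ⟨0, h0⟩).ne' hbdd.measure_lt_top.ne

/-- The sub-mean value property at the centre of Ω is attained by constants. -/
lemma bergmanKernel_zero (hopen : IsOpen Ω) (h0 : 0 ∈ Ω) (hbdd : Bornology.IsBounded Ω)
    (hcirc : ∀ z ∈ Ω, ∀ t : ℂ, ‖t‖ ≤ 1 → t • z ∈ Ω) (hp : 0 < p) :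
    bergmanKernel p Ω 0 = (volume.real Ω)⁻¹ := by
  have hV := measureReal_pos_of_isOpen hopen h0 hbdd
  refine le_antisymm (bergmanKernel_le hp (by positivity) fun f hf => ?_) ?_
  · rw [← div_eq_inv_mul, le_div_iff₀ hV, mul_comm]
    exact measureReal_mul_norm_rpow_le hopen hcirc hbdd.measure_lt_top.ne hp hf
  · have h1 : MemBergman p Ω fun _ : Fin n → ℂ => (1 : ℂ) :=
      ⟨by fun_prop, integrableOn_norm_rpow_of_continuous hbdd continuous_const hp⟩
    have := le_bergmanKernel hopen hp h0 h1 ⟨0, h0, one_ne_zero⟩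
    simpa using this

lemma memBergman_linear (hbdd : Bornology.IsBounded Ω) (hp : 0 < p)
    (g : (Fin n → ℂ) →L[ℂ] ℂ) : MemBergman p Ω g :=
  ⟨g.differentiable.differentiableOn, integrableOn_norm_rpow_of_continuous hbdd g.continuous hp⟩

/-- The `p`-Bergman metric at the centre is computed by linear functionals. -/
lemma bergmanMetric_zero (hopen : IsOpen Ω) (h0 : 0 ∈ Ω) (hbdd : Bornology.IsBounded Ω)
    (hcirc : ∀ z ∈ Ω, ∀ t : ℂ, ‖t‖ ≤ 1 → t • z ∈ Ω) (hp : 0 < p) {X : Fin n → ℂ}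
    {g₀ : (Fin n → ℂ) →L[ℂ] ℂ} (hg₀ : g₀ X = 1)
    (hmin : ∀ g : (Fin n → ℂ) →L[ℂ] ℂ,
      ‖g X‖ ^ p * ∫ z in Ω, ‖g₀ z‖ ^ p ≤ ∫ z in Ω, ‖g z‖ ^ p) :
    bergmanMetric p Ω 0 X = (((∫ z in Ω, ‖g₀ z‖ ^ p) / volume.real Ω) ^ (1 / p))⁻¹ := by
  have hV := measureReal_pos_of_isOpen hopen h0 hbdd
  have hg0 : g₀ ≠ 0 := by rintro rfl; simp at hg₀
  have hI := setIntegral_norm_rpow_pos hopen h0 hbdd hp hg0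
  set I := ∫ z in Ω, ‖g₀ z‖ ^ p with hIdef
  have hsup : sSup {t : ℝ | ∃ f : (Fin n → ℂ) → ℂ, MemBergman p Ω f ∧ f 0 = 0 ∧
      0 < bergmanNorm p Ω f ∧ t = ‖fderiv ℂ f 0 X‖ / bergmanNorm p Ω f} = (I ^ (1 / p))⁻¹ := by
    refine IsGreatest.csSup_eq ⟨⟨g₀, memBergman_linear hbdd hp g₀, map_zero g₀,
      Real.rpow_pos_of_pos hI _, ?_⟩, ?_⟩
    · rw [ContinuousLinearMap.fderiv, hg₀, norm_one, ← one_div]; rfl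
    · rintro t ⟨f, hf, hf0, hpos, rfl⟩
      -- Replacing f by its linear part keeps Xf(0) and does not increase the norm.
      have h1 := setIntegral_fderiv_rpow_le hopen h0 hcirc hp hf hf0
        (memBergman_linear hbdd hp (fderiv ℂ f 0)).2
      have h2 := (hmin (fderiv ℂ f 0)).trans h1
      have h3 := Real.rpow_le_rpow (by positivity) h2 (by positivity : (0 : ℝ) ≤ 1 / p)
      rw [Real.mul_rpow (by positivity) hI.le, ← Real.rpow_mul (norm_nonneg _),
        mul_one_div_cancel hp.ne', Real.rpow_one] at h3
      rw [div_le_iff₀ hpos, ← div_eq_inv_mul, le_div_iff₀ (Real.rpow_pos_of_pos hI _)]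
      exact h3
  rw [bergmanMetric, hsup, bergmanKernel_zero hopen h0 hbdd hcirc hp, Real.div_rpow hI.le hV.le,
    Real.rpow_neg (by positivity), Real.inv_rpow hV.le, inv_inv, inv_div, div_eq_mul_inv (volume.real Ω ^ (1 / p))]

/-- Lower bound for the kernel near the centre, from the `2/p`-th power of an affine function. -/
lemma one_add_le_bergmanKernel (hopen : IsOpen Ω) (h0 : 0 ∈ Ω) (hbdd : Bornology.IsBounded Ω)
    (hcirc : ∀ z ∈ Ω, ∀ t : ℂ, ‖t‖ ≤ 1 → t • z ∈ Ω) (hp : 0 < p) {X : Fin n → ℂ}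
    {g₀ : (Fin n → ℂ) →L[ℂ] ℂ} (hg₀ : g₀ X = 1) :
    ∀ᶠ r : ℝ in 𝓝 0, 1 + volume.real Ω / (∫ z in Ω, ‖g₀ z‖ ^ (2 : ℝ)) * r ^ 2 ≤
      volume.real Ω * bergmanKernel p Ω ((r : ℂ) • X) := by
  have hV := measureReal_pos_of_isOpen hopen h0 hbdd
  have hg0 : g₀ ≠ 0 := by rintro rfl; simp at hg₀
  have hI := setIntegral_norm_rpow_pos hopen h0 hbdd two_pos hg0
  set I := ∫ z in Ω, ‖g₀ z‖ ^ (2 : ℝ) with hIdef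
  set V := volume.real Ω with hVdef
  set l := V / I with hl
  have hlpos : 0 < l := div_pos hV hI
  obtain ⟨M, hM⟩ := hbdd.exists_norm_le
  have hsmall : ∀ᶠ r : ℝ in 𝓝 0, ‖g₀‖ * (|M| + 1) * (l * |r|) < 1 := by
    have : Tendsto (fun r : ℝ => ‖g₀‖ * (|M| + 1) * (l * |r|)) (𝓝 0)
        (𝓝 (‖g₀‖ * (|M| + 1) * (l * |0|))) :=
      Continuous.tendsto (by fun_prop) 0
    exact this.eventually_lt_const (by simp)
  have hmem : ∀ᶠ r : ℝ in 𝓝 0, (r : ℂ) • X ∈ Ω := by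
    have : Tendsto (fun r : ℝ => (r : ℂ) • X) (𝓝 0) (𝓝 (((0 : ℝ) : ℂ) • X)) :=
      Continuous.tendsto (by fun_prop) 0
    exact this.eventually_mem (by simpa using hopen.mem_nhds h0)
  filter_upwards [hsmall, hmem] with r hr hrX
  -- The slope l r maximizes (1 + s r)² / (V + s² I), the kernel quotient at rX of (1 + s g₀)^(2/p).
  let s : ℂ := ((l * r : ℝ) : ℂ)
  let F : (Fin n → ℂ) → ℂ := fun z => 1 + s * g₀ z
  have hFc : Continuous F := by fun_prop
  have hslit : ∀ z ∈ Ω, F z ∈ Complex.slitPlane := by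
    intro z hz
    refine Complex.mem_slitPlane_of_norm_lt_one ?_
    have h1 : ‖s‖ = l * |r| := by
      simp only [s, Complex.norm_real, Real.norm_eq_abs, abs_mul, abs_of_pos hlpos]
    rw [norm_mul, h1, mul_comm]
    refine lt_of_le_of_lt ?_ hr
    gcongr
    exact (g₀.le_opNorm z).trans (by gcongr; linarith [hM z hz, le_abs_self M])
  let f : (Fin n → ℂ) → ℂ := fun z => F z ^ ((2 / p : ℝ) : ℂ)
  have hfn : ∀ z, ‖f z‖ ^ p = ‖F z‖ ^ (2 : ℝ) := fun z => by
    simp only [f]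
    rw [Complex.norm_cpow_real, ← Real.rpow_mul (norm_nonneg _), div_mul_cancel₀ _ hp.ne']
  have hFd : DifferentiableOn ℂ F Ω := by fun_prop
  have hf : MemBergman p Ω f := by
    refine ⟨hFd.cpow (differentiableOn_const _) hslit, ?_⟩
    simp only [hfn]
    exact integrableOn_norm_rpow_of_continuous hbdd hFc two_pos
  have hint : ∫ z in Ω, ‖f z‖ ^ p = V * (1 + l * r ^ 2) := by
    have hfin : volume Ω ≠ ⊤ := hbdd.measure_lt_top.ne
    have hgint : IntegrableOn (fun z => g₀ z) Ω :=
      (g₀.continuous.continuousOn.integrableOn_compact hbdd.isCompact_closure).mono_set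
        subset_closure
    -- Invariance of Ω under z ↦ -z kills the cross term of |1 + s g₀|².
    have hzero : ∫ z in Ω, g₀ z = 0 := by
      have := setIntegral_comp_rotation hopen.measurableSet hcirc (c := -1) (by simp) g₀
      simp only [neg_smul, one_smul, map_neg, integral_neg] at this
      exact self_eq_neg.mp this.symm
    have hre : ∫ z in Ω, (g₀ z).re = 0 := by
      have := integral_re hgint
      simp only [RCLike.re_eq_complex_re] at this
      rw [this, hzero]; simp
    have hexp : ∀ z, ‖f z‖ ^ p
        = 1 + 2 * (l * r) * (g₀ z).re + (l * r) ^ 2 * ‖g₀ z‖ ^ (2 : ℝ) := fun z => by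
      rw [hfn, Real.rpow_two, Real.rpow_two, Complex.sq_norm, Complex.sq_norm,
        Complex.normSq_apply, Complex.normSq_apply]
      simp only [F, s, Complex.add_re, Complex.add_im, Complex.one_re, Complex.one_im,
        Complex.re_ofReal_mul, Complex.im_ofReal_mul]
      ring
    simp only [hexp]
    rw [integral_add, integral_add, integral_const_mul, integral_const_mul, hre, ← hIdef,
      setIntegral_const, smul_eq_mul, ← hVdef]
    · rw [hl]; field_simp; ring
    · exact integrableOn_const hfin
    · exact hgint.re.const_mul _
    · exact (integrableOn_const hfin).add (hgint.re.const_mul _)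
    · exact (integrableOn_norm_rpow_of_continuous hbdd g₀.continuous two_pos).const_mul _
  have hval : ‖f ((r : ℂ) • X)‖ ^ p = (1 + l * r ^ 2) ^ 2 := by
    have h1 : F ((r : ℂ) • X) = ((1 + l * r ^ 2 : ℝ) : ℂ) := by
      simp only [F, s, map_smul, hg₀]; push_cast; simp; ring
    rw [hfn, h1, Complex.norm_real, Real.rpow_two, Real.norm_eq_abs, sq_abs]
  have hle := le_bergmanKernel hopen hp hrX hf ⟨0, h0, by simp [f, F]⟩
  rw [hint, hval] at hle
  have h2 : 0 < 1 + l * r ^ 2 := by positivity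
  calc 1 + l * r ^ 2 = V * ((1 + l * r ^ 2) ^ 2 / (V * (1 + l * r ^ 2))) := by field_simp
    _ ≤ _ := by gcongr

end Kernel

/-! ### Rigidity of nearly extremal functions -/

section UpperBound

open Metric Real

variable {n : ℕ} {Ω : Set (Fin n → ℂ)} {p : ℝ}

/-- Uniform Lipschitz estimate on a compact set for the unit ball of the `p`-Bergman space. -/
lemma exists_uniform_lipschitz (hopen : IsOpen Ω) (hp : 0 < p) {K : Set (Fin n → ℂ)}
    (hK : IsCompact K) (hKΩ : K ⊆ Ω) (V : ℝ) :
    ∃ C > 0, ∃ δ > 0, ∀ f, MemBergman p Ω f → ∫ w in Ω, ‖f w‖ ^ p ≤ V → ∀ z ∈ K,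
      ball z δ ⊆ Ω ∧ ∀ w ∈ ball z δ, ‖f w - f z‖ ≤ C * ‖w - z‖ := by
  obtain ⟨d, hd, hthick⟩ := hK.exists_thickening_subset_open hopen hKΩ
  set δ := d / 2 with hδ
  have hδ0 : 0 < δ := by positivity
  set v := volume.real (ball (0 : Fin n → ℂ) δ) with hv
  have hv0 : 0 < v :=
    ENNReal.toReal_pos (measure_ball_pos volume _ hδ0).ne' measure_ball_lt_top.ne
  set M := (|V| / v + 1) ^ (1 / p) with hM
  have hM0 : 0 < M := by positivity
  refine ⟨2 * M / δ, by positivity, δ, hδ0, fun f hf hfV z hz => ?_⟩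
  have hsub : ball z d ⊆ Ω := (ball_subset_thickening hz d).trans hthick
  have hsub' : ball z δ ⊆ Ω := (ball_subset_ball (by linarith)).trans hsub
  have hbound : ∀ w ∈ ball z δ, ‖f w‖ ≤ M := by
    intro w hw
    have h1 := norm_rpow_le_of_ball_subset hp hf (z := w) (δ := δ)
      ((ball_subset_ball' (by rw [mem_ball] at hw; linarith)).trans hsub)
    have h2 : ‖f w‖ ^ p ≤ |V| / v + 1 := by
      rw [← hv] at h1
      have : ‖f w‖ ^ p ≤ |V| / v := by
        rw [le_div_iff₀ hv0]; linarith [le_abs_self V]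
      linarith
    have h3 := Real.rpow_le_rpow (by positivity) h2 (by positivity : (0 : ℝ) ≤ 1 / p)
    rwa [← Real.rpow_mul (norm_nonneg _), mul_one_div_cancel hp.ne', Real.rpow_one] at h3
  refine ⟨hsub', fun w hw => ?_⟩
  -- Schwarz lemma: |f| ≤ M on the δ-ball, so f maps it into the disc of radius 2M about f(z).
  have h1 := Complex.dist_le_div_mul_dist_of_mapsTo_ball (R₂ := 2 * M) (hf.1.mono hsub')
    (fun u hu => by
      rw [mem_closedBall, dist_eq_norm]
      have h2 := hbound u hu
      have h3 := hbound z (mem_ball_self hδ0)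
      linarith [norm_sub_le (f u) (f z)]) hw
  simpa [dist_eq_norm] using h1

lemma MemBergman.mono_exponent (hopen : IsOpen Ω) (hbdd : Bornology.IsBounded Ω) {s : ℝ}
    (hs : 0 < s) (hsp : s ≤ p) {f : (Fin n → ℂ) → ℂ} (hf : MemBergman p Ω f) :
    MemBergman s Ω f := by
  refine ⟨hf.1, ?_⟩
  have h1 : IntegrableOn (fun z => 1 + ‖f z‖ ^ p) Ω :=
    (integrableOn_const hbdd.measure_lt_top.ne).add hf.2
  refine Integrable.mono' h1 ?_ (ae_of_all _ fun z => ?_)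
  · exact (hf.1.continuousOn.norm.rpow_const fun _ _ => Or.inr hs.le).aestronglyMeasurable
      hopen.measurableSet
  · rw [Real.norm_of_nonneg (by positivity)]
    rcases le_total ‖f z‖ 1 with h | h
    · have := Real.rpow_le_one (norm_nonneg _) h hs.le
      have : 0 ≤ ‖f z‖ ^ p := by positivity
      linarith
    · have := Real.rpow_le_rpow_of_exponent_le h hsp
      linarith

/-- Deviation of `‖f‖ ^ (p / 2)` from its value at the centre, in mean square. -/
lemma setIntegral_sq_sub_le (hopen : IsOpen Ω) (hbdd : Bornology.IsBounded Ω)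
    (hcirc : ∀ z ∈ Ω, ∀ t : ℂ, ‖t‖ ≤ 1 → t • z ∈ Ω) (hp : 0 < p) {f : (Fin n → ℂ) → ℂ}
    (hf : MemBergman p Ω f) :
    IntegrableOn (fun w => (‖f w‖ ^ (p / 2) - ‖f 0‖ ^ (p / 2)) ^ 2) Ω ∧
    ∫ w in Ω, (‖f w‖ ^ (p / 2) - ‖f 0‖ ^ (p / 2)) ^ 2 ≤
      (∫ w in Ω, ‖f w‖ ^ p) - volume.real Ω * ‖f 0‖ ^ p := by
  have hfin : volume Ω ≠ ⊤ := hbdd.measure_lt_top.ne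
  have hs : 0 < p / 2 := by positivity
  have hf2 := hf.mono_exponent hopen hbdd hs (by linarith)
  -- The sub-mean value inequality with exponent p/2 controls the cross term of the square.
  have hsub := measureReal_mul_norm_rpow_le hopen hcirc hfin hs hf2
  have hsq : ∀ x : ℝ, 0 ≤ x → (x ^ (p / 2)) ^ 2 = x ^ p := fun x hx => by
    rw [← Real.rpow_natCast, ← Real.rpow_mul hx]; congr 1; push_cast; ring
  set a := ‖f 0‖ ^ (p / 2) with ha
  have ha0 : 0 ≤ a := by positivity
  have hexp : ∀ w, (‖f w‖ ^ (p / 2) - a) ^ 2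
      = ‖f w‖ ^ p - 2 * a * ‖f w‖ ^ (p / 2) + a ^ 2 := fun w => by
    rw [sub_sq, hsq _ (norm_nonneg _)]; ring
  have hc : IntegrableOn (fun _ : Fin n → ℂ => a ^ 2) Ω := integrableOn_const hfin
  have hd : IntegrableOn (fun w => ‖f w‖ ^ p - 2 * a * ‖f w‖ ^ (p / 2)) Ω :=
    hf.2.sub (hf2.2.const_mul _)
  simp only [hexp]
  refine ⟨hd.add hc, ?_⟩
  rw [integral_add hd hc, integral_sub hf.2 (hf2.2.const_mul _), integral_const_mul,
    setIntegral_const, smul_eq_mul, ← hsq _ (norm_nonneg _), ← ha]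
  nlinarith [mul_le_mul_of_nonneg_left hsub ha0]

/-- Functions of `p`-mean `1` and almost maximal modulus at the centre have modulus close to `1`,
uniformly on compact sets. -/
lemma exists_forall_abs_norm_sub_one_le (hopen : IsOpen Ω) (h0 : 0 ∈ Ω)
    (hbdd : Bornology.IsBounded Ω) (hcirc : ∀ z ∈ Ω, ∀ t : ℂ, ‖t‖ ≤ 1 → t • z ∈ Ω) (hp : 0 < p)
    {K : Set (Fin n → ℂ)} (hK : IsCompact K) (hKΩ : K ⊆ Ω) {ε : ℝ} (hε : 0 < ε) (hε1 : ε < 1) :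
    ∃ η > 0, ∀ f, MemBergman p Ω f → ∫ w in Ω, ‖f w‖ ^ p = volume.real Ω → 1 - η ≤ ‖f 0‖ →
      ∀ z ∈ K, |‖f z‖ - 1| ≤ ε := by
  set V := volume.real Ω with hV
  have hV0 : 0 < V := measureReal_pos_of_isOpen hopen h0 hbdd
  obtain ⟨C, hC, δ, hδ, hLip⟩ := exists_uniform_lipschitz hopen hp hK hKΩ V
  set s := p / 2 with hs
  have hs0 : 0 < s := by positivity
  -- By the Lipschitz bound, a deviation of | |f| - 1 | beyond ε at z stays beyond ε/2 on the ball
  -- of radius d.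
  set d := min δ (ε / (2 * C)) with hd
  have hd0 : 0 < d := lt_min hδ (by positivity)
  set v := volume.real (ball (0 : Fin n → ℂ) d) with hv
  have hv0 : 0 < v :=
    ENNReal.toReal_pos (measure_ball_pos volume _ hd0).ne' measure_ball_lt_top.ne
  -- For 1 - ε/4 ≤ |f(0)| ≤ 1, c₁ and c₂ are the least gaps between |f|^s and |f(0)|^s when |f| ≥ 1
  -- + ε/2 or |f| ≤ 1 - ε/2. Then η is chosen so that the mean-square deviation is below c² v, the
  -- amount a bad ball would contribute.
  set c₁ := (1 + ε / 2) ^ s - 1 with hc₁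
  set c₂ := (1 - ε / 4) ^ s - (1 - ε / 2) ^ s with hc₂
  have hc₁0 : 0 < c₁ := sub_pos.mpr (Real.one_lt_rpow (by linarith) hs0)
  have hc₂0 : 0 < c₂ := sub_pos.mpr (Real.rpow_lt_rpow (by linarith) (by linarith) hs0)
  set c := min c₁ c₂ with hc
  have hc0 : 0 < c := lt_min hc₁0 hc₂0
  obtain ⟨η, hη0, hηε, hη⟩ : ∃ η : ℝ, 0 < η ∧ η < ε / 4 ∧ V * (1 - (1 - η) ^ p) < c ^ 2 * v := by
    have ht : Tendsto (fun η : ℝ => V * (1 - (1 - η) ^ p)) (𝓝 0) (𝓝 (V * (1 - (1 - 0) ^ p))) :=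
      Continuous.tendsto (continuous_const.mul (continuous_const.sub
        ((continuous_const.sub continuous_id).rpow_const fun _ => Or.inr hp.le))) 0
    have h1 := ht.eventually_lt_const (u := c ^ 2 * v) (by
      rw [sub_zero, Real.one_rpow, sub_self, mul_zero]; positivity)
    have h2 : ∀ᶠ η : ℝ in 𝓝 0, η < ε / 4 := gt_mem_nhds (by positivity)
    obtain ⟨η, ⟨h3, h4⟩, h5⟩ := (((h1.and h2).filter_mono nhdsWithin_le_nhds).and
      (self_mem_nhdsWithin (s := Set.Ioi (0 : ℝ)) (a := 0))).exists
    exact ⟨η, h5, h4, h3⟩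
  refine ⟨η, hη0, fun f hf hfV hfa z hz => ?_⟩
  by_contra! hdev
  obtain ⟨hballΩ, hlip⟩ := hLip f hf hfV.le z hz
  set a := ‖f 0‖ with ha
  have ha1 : a ≤ 1 := by
    have := measureReal_mul_norm_rpow_le hopen hcirc hbdd.measure_lt_top.ne hp hf
    rw [hfV, ← hV] at this
    have h2 : a ^ p ≤ 1 := by
      by_contra! h; nlinarith
    by_contra! h
    exact h2.not_gt (Real.one_lt_rpow h hp)
  have hlow : ∀ w ∈ ball z d, c ^ 2 ≤ (‖f w‖ ^ s - a ^ s) ^ 2 := by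
    intro w hw
    have hwδ : w ∈ ball z δ := ball_subset_ball (min_le_left _ _) hw
    have h1 : ‖f w - f z‖ ≤ ε / 2 := by
      refine (hlip w hwδ).trans ?_
      have : ‖w - z‖ ≤ ε / (2 * C) := by
        rw [← dist_eq_norm]; exact (mem_ball.mp hw).le.trans (min_le_right _ _)
      calc C * ‖w - z‖ ≤ C * (ε / (2 * C)) := by gcongr
        _ = ε / 2 := by field_simp
    have h2 := abs_norm_sub_norm_le (f w) (f z)
    have h3 := abs_le.mp (h2.trans h1)
    rw [sq_le_sq, abs_of_pos hc0]
    rcases lt_abs.mp hdev with h | h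
    · have h4 : (1 + ε / 2) ^ s ≤ ‖f w‖ ^ s :=
        Real.rpow_le_rpow (by positivity) (by linarith) hs0.le
      have h5 : a ^ s ≤ 1 := Real.rpow_le_one (norm_nonneg _) ha1 hs0.le
      exact (min_le_left _ _).trans (le_trans (by linarith) (le_abs_self _))
    · have h4 : ‖f w‖ ^ s ≤ (1 - ε / 2) ^ s :=
        Real.rpow_le_rpow (by positivity) (by linarith) hs0.le
      have h5 : (1 - ε / 4) ^ s ≤ a ^ s :=
        Real.rpow_le_rpow (by linarith) (by linarith) hs0.le
      exact (min_le_right _ _).trans (le_trans (by linarith) (neg_le_abs _))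
  obtain ⟨hDint, hDle⟩ := setIntegral_sq_sub_le hopen hbdd hcirc hp hf
  have hsubΩ : ball z d ⊆ Ω := (ball_subset_ball (min_le_left _ _)).trans hballΩ
  have hvz : volume.real (ball z d) = v := by
    rw [hv, measureReal_def, measureReal_def, Measure.addHaar_ball_center]
  have h1 : c ^ 2 * v ≤ ∫ w in ball z d, (‖f w‖ ^ s - a ^ s) ^ 2 := by
    have := setIntegral_ge_of_const_le_real (μ := volume) (s := ball z d) measurableSet_ball
      measure_ball_lt_top.ne hlow (hDint.mono_set hsubΩ)
    rwa [hvz] at this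
  have h2 : ∫ w in ball z d, (‖f w‖ ^ s - a ^ s) ^ 2 ≤ ∫ w in Ω, (‖f w‖ ^ s - a ^ s) ^ 2 :=
    setIntegral_mono_set hDint (ae_of_all _ fun w => by positivity)
      (LE.le.eventuallyLE hsubΩ)
  rw [hfV] at hDle
  have h3 : (1 - η) ^ p ≤ a ^ p := Real.rpow_le_rpow (by linarith) hfa hp.le
  have h4 : V - V * a ^ p ≤ V * (1 - (1 - η) ^ p) := by nlinarith
  linarith

/-- Sharp second-order lower bound for `∫ ‖f‖ ^ p` when `f` has no zeros on the compact circled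
set `K`. -/
lemma norm_rpow_mul_le_setIntegral (hopen : IsOpen Ω) (h0 : 0 ∈ Ω)
    (hbdd : Bornology.IsBounded Ω) (hcirc : ∀ z ∈ Ω, ∀ t : ℂ, ‖t‖ ≤ 1 → t • z ∈ Ω) (hp : 0 < p)
    {K : Set (Fin n → ℂ)} (hK : IsCompact K) (hKΩ : K ⊆ Ω)
    (hKcirc : ∀ z ∈ K, ∀ t : ℂ, ‖t‖ ≤ 1 → t • z ∈ K) {f : (Fin n → ℂ) → ℂ}
    (hf : MemBergman p Ω f) (hne : ∀ z ∈ K, f z ≠ 0) :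
    ‖f 0‖ ^ p * (volume.real Ω
      + p ^ 2 / 4 * ∫ z in K, ‖((f 0)⁻¹ • fderiv ℂ f 0) z‖ ^ (2 : ℝ)) ≤ ∫ w in Ω, ‖f w‖ ^ p := by
  set g : (Fin n → ℂ) →L[ℂ] ℂ := (f 0)⁻¹ • fderiv ℂ f 0 with hg
  have hfin : volume Ω ≠ ⊤ := hbdd.measure_lt_top.ne
  have hi : IntegrableOn (K.indicator fun z => ‖g z‖ ^ (2 : ℝ)) Ω :=
    (integrableOn_norm_rpow_of_continuous hbdd g.continuous two_pos).indicator hK.measurableSet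
  -- Slices through K get the sharp zero-free bound; the others only the sub-mean value inequality,
  -- hence the indicator.
  have hle := setIntegral_le_of_le_circleAverage hopen.measurableSet hcirc hf.2
    (φ := fun z => ‖f 0‖ ^ p + ‖f 0‖ ^ p * (p ^ 2 / 4)
      * K.indicator (fun z => ‖g z‖ ^ (2 : ℝ)) z)
    ((integrableOn_const hfin).add (hi.const_mul _)) fun z hz => ?_
  · have hc : IntegrableOn (fun _ : Fin n → ℂ => ‖f 0‖ ^ p) Ω := integrableOn_const hfin
    rw [integral_add hc (hi.const_mul _), integral_const_mul,
      setIntegral_const, setIntegral_indicator hK.measurableSet,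
      Set.inter_eq_self_of_subset_right hKΩ, smul_eq_mul] at hle
    refine le_trans (le_of_eq ?_) hle
    ring
  · have hsub : closedBall (0 : ℂ) 1 ⊆ {t : ℂ | t • z ∈ Ω} :=
      fun t ht => hcirc z hz t (by simpa using ht)
    by_cases hzK : z ∈ K
    · have h1 := norm_rpow_mul_le_circleAverage_of_ne_zero (p := p) (isOpen_slice hopen z) hsub
        (differentiableOn_slice hf.1 z)
        (fun t ht => hne _ (hKcirc z hzK t (by simpa using ht)))
      rw [deriv_slice hopen h0 hf.1, zero_smul] at h1
      simp only [Set.indicator_of_mem hzK]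
      refine le_trans (le_of_eq ?_) h1
      rw [hg, smul_apply, smul_eq_mul, div_eq_inv_mul (fderiv ℂ f 0 z), Real.rpow_two]
      ring
    · simp only [Set.indicator_of_notMem hzK, mul_zero, add_zero]
      have h1 := norm_rpow_le_circleAverage hp
        (((differentiableOn_slice hf.1 z).analyticOnNhd (isOpen_slice hopen z)).mono hsub)
      simpa using h1

/-- Exhaustion of a circled domain by compact circled sets. -/
lemma exists_compact_circled (hopen : IsOpen Ω) (h0 : 0 ∈ Ω) (hbdd : Bornology.IsBounded Ω)
    (hcirc : ∀ z ∈ Ω, ∀ t : ℂ, ‖t‖ ≤ 1 → t • z ∈ Ω) {τ : ℝ} (hτ : 0 < τ) :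
    ∃ K, IsCompact K ∧ K ⊆ Ω ∧ (∀ z ∈ K, ∀ t : ℂ, ‖t‖ ≤ 1 → t • z ∈ K) ∧
      (∃ ρ > 0, closedBall 0 ρ ⊆ K) ∧ volume.real (Ω \ K) ≤ τ := by
  have hfin : volume Ω ≠ ⊤ := hbdd.measure_lt_top.ne
  obtain ⟨ρ, hρ, hρΩ⟩ := Metric.nhds_basis_closedBall.mem_iff.mp (hopen.mem_nhds h0)
  obtain ⟨K₀, hK₀Ω, hK₀, hK₀vol⟩ := hopen.measurableSet.exists_isCompact_sdiff_lt hfin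
    (ENNReal.ofReal_pos.mpr hτ).ne'
  let K₁ := K₀ ∪ closedBall (0 : Fin n → ℂ) ρ
  have hK₁ : IsCompact K₁ := hK₀.union (isCompact_closedBall _ _)
  have hK₁Ω : K₁ ⊆ Ω := Set.union_subset hK₀Ω hρΩ
  -- The circled hull of K₁, compact as a continuous image and inside Ω as Ω is circled.
  let K := (fun q : ℂ × (Fin n → ℂ) => q.1 • q.2) '' (closedBall 0 1 ×ˢ K₁)
  have hK₁K : K₁ ⊆ K := fun z hz => ⟨(1, z), ⟨by simp, hz⟩, one_smul _ _⟩
  refine ⟨K, ((isCompact_closedBall _ _).prod hK₁).image (by fun_prop), ?_, ?_,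
    ⟨ρ, hρ, Set.subset_union_right.trans hK₁K⟩, ?_⟩
  · rintro _ ⟨q, ⟨hq1, hq2⟩, rfl⟩
    exact hcirc _ (hK₁Ω hq2) _ (by simpa using hq1)
  · rintro _ ⟨q, ⟨hq1, hq2⟩, rfl⟩ t ht
    refine ⟨(t * q.1, q.2), ⟨?_, hq2⟩, mul_smul _ _ _⟩
    have : ‖q.1‖ ≤ 1 := by simpa using hq1
    simpa using mul_le_one₀ ht (norm_nonneg _) this
  · have h1 : volume (Ω \ K) ≤ ENNReal.ofReal τ :=
      (measure_mono (Set.sdiff_subset_sdiff_right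
        (Set.subset_union_left.trans hK₁K))).trans hK₀vol.le
    exact ENNReal.toReal_le_of_le_ofReal hτ.le h1

lemma exists_mul_norm_sq_le_setIntegral (hopen : IsOpen Ω) (h0 : 0 ∈ Ω)
    (hbdd : Bornology.IsBounded Ω) :
    ∃ κ > 0, ∀ g : (Fin n → ℂ) →L[ℂ] ℂ, κ * ‖g‖ ^ 2 ≤ ∫ z in Ω, ‖g z‖ ^ (2 : ℝ) := by
  rcases (sphere (0 : (Fin n → ℂ) →L[ℂ] ℂ) 1).eq_empty_or_nonempty with he | hne
  · refine ⟨1, one_pos, fun g => ?_⟩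
    by_cases hg : g = 0
    · simp [hg]
    · exfalso
      have : ((‖g‖⁻¹ : ℝ) : ℂ) • g ∈ sphere (0 : (Fin n → ℂ) →L[ℂ] ℂ) 1 := by
        rw [mem_sphere_zero_iff_norm, norm_smul]; simp [hg]
      rw [he] at this
      exact this
  · obtain ⟨g₁, hg₁, hmin⟩ := (isCompact_sphere _ _).exists_isMinOn hne
      (continuous_setIntegral_norm_rpow hopen hbdd two_pos).continuousOn
    have hg₁0 : g₁ ≠ 0 := by rintro rfl; simp at hg₁
    refine ⟨_, setIntegral_norm_rpow_pos hopen h0 hbdd two_pos hg₁0, fun g => ?_⟩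
    by_cases hg : g = 0
    · simp [hg]
    · have hgn : 0 < ‖g‖ := norm_pos_iff.mpr hg
      have h1 : ((‖g‖⁻¹ : ℝ) : ℂ) • g ∈ sphere (0 : (Fin n → ℂ) →L[ℂ] ℂ) 1 := by
        rw [mem_sphere_zero_iff_norm, norm_smul]; simp [hg]
      have h2 := hmin h1
      have h3 : ∫ z in Ω, ‖(((‖g‖⁻¹ : ℝ) : ℂ) • g) z‖ ^ (2 : ℝ)
          = (‖g‖ ^ 2)⁻¹ * ∫ z in Ω, ‖g z‖ ^ (2 : ℝ) := by
        rw [← integral_const_mul]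
        congr with z
        simp only [smul_apply, smul_eq_mul, norm_mul, Complex.norm_real, norm_inv, norm_norm,
          Real.rpow_two, mul_pow, inv_pow]
      simp only [Set.mem_ofPred_eq, h3] at h2
      rw [← div_eq_inv_mul, le_div_iff₀ (by positivity)] at h2
      exact h2

/-- The `L²`-norms of linear functionals on `Ω` and on a large compact subset are comparable with
constant close to `1`. -/
lemma exists_forall_setIntegral_le_mul (hopen : IsOpen Ω) (h0 : 0 ∈ Ω)
    (hbdd : Bornology.IsBounded Ω) {ε : ℝ} (hε : 0 < ε) :
    ∃ τ > 0, ∀ K, IsCompact K → K ⊆ Ω → volume.real (Ω \ K) ≤ τ →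
      ∀ g : (Fin n → ℂ) →L[ℂ] ℂ,
        ∫ z in Ω, ‖g z‖ ^ (2 : ℝ) ≤ (1 + ε) * ∫ z in K, ‖g z‖ ^ (2 : ℝ) := by
  obtain ⟨κ, hκ, hle⟩ := exists_mul_norm_sq_le_setIntegral hopen h0 hbdd
  obtain ⟨R, hR⟩ := hbdd.exists_norm_le
  have hfin : volume Ω ≠ ⊤ := hbdd.measure_lt_top.ne
  -- Chosen so that Ω \ K carries at most the fraction ε/(1 + ε) of the integral, leaving 1/(1 + ε)
  -- for K.
  refine ⟨κ * (ε / (1 + ε)) / (R ^ 2 + 1), by positivity, fun K hK hKΩ hvol g => ?_⟩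
  have hi := integrableOn_norm_rpow_of_continuous hbdd g.continuous two_pos
  have hsplit : ∫ z in Ω, ‖g z‖ ^ (2 : ℝ)
      = (∫ z in K, ‖g z‖ ^ (2 : ℝ)) + ∫ z in Ω \ K, ‖g z‖ ^ (2 : ℝ) := by
    rw [setIntegral_sdiff hK.measurableSet hi hKΩ]; ring
  have hsmall : ∫ z in Ω \ K, ‖g z‖ ^ (2 : ℝ) ≤ (‖g‖ ^ 2 * R ^ 2) * volume.real (Ω \ K) := by
    have h1 : ∀ z ∈ Ω \ K, ‖‖g z‖ ^ (2 : ℝ)‖ ≤ ‖g‖ ^ 2 * R ^ 2 := by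
      intro z hz
      rw [Real.norm_of_nonneg (by positivity), Real.rpow_two, ← mul_pow]
      have := hR z hz.1
      exact pow_le_pow_left₀ (norm_nonneg _) ((g.le_opNorm z).trans (by gcongr)) 2
    have h2 := norm_setIntegral_le_of_norm_le_const
      ((measure_mono Set.sdiff_subset).trans_lt hfin.lt_top) h1
    exact (le_abs_self _).trans h2
  have hbound : ∫ z in Ω \ K, ‖g z‖ ^ (2 : ℝ) ≤ ε / (1 + ε) * ∫ z in Ω, ‖g z‖ ^ (2 : ℝ) := by
    calc _ ≤ (‖g‖ ^ 2 * R ^ 2) * volume.real (Ω \ K) := hsmall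
      _ ≤ (‖g‖ ^ 2 * (R ^ 2 + 1)) * (κ * (ε / (1 + ε)) / (R ^ 2 + 1)) := by gcongr; linarith
      _ = ε / (1 + ε) * (κ * ‖g‖ ^ 2) := by field_simp
      _ ≤ _ := by gcongr; exact hle g
  set A := ∫ z in Ω, ‖g z‖ ^ (2 : ℝ)
  set B := ∫ z in K, ‖g z‖ ^ (2 : ℝ)
  have h5 : A - ε / (1 + ε) * A = A / (1 + ε) := by field_simp; ring
  have h6 : A / (1 + ε) ≤ B := by linarith
  rwa [div_le_iff₀ (by positivity), mul_comm] at h6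

end UpperBound

/-! ### Second-order upper bound and the value of the Levi form -/

section LeviForm

open Metric Real

variable {n : ℕ} {Ω : Set (Fin n → ℂ)} {p : ℝ}

/-- Optimization step in the second-order upper bound. -/
lemma rpow_le_exp_of_le_mul {p l ε ε₁ a b q r t y : ℝ} (hp : 0 < p) (hl0 : 0 < l)
    (hε₁ : 0 < ε₁) (ha0 : 0 < a) (hr0 : 0 < r) (ht0 : 0 ≤ t)
    (hy0 : 0 ≤ y) (hyε : y ≤ ε₁) (hε₁l : (1 + ε₁) ^ 2 * l ≤ l + ε / 2) (hbε : p * b ≤ ε / 2)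
    (hay : a ^ p * (1 + y) ≤ 1) (hgX : q ^ 2 * p ^ 2 ≤ 4 * (1 + ε₁) * l * y)
    (haffine : t ≤ a * (1 + (q * r + b * r ^ 2))) :
    t ^ p ≤ Real.exp ((l + ε) * r ^ 2) := by
  -- AM–GM balances the first-order gain q r against y, the price paid in |f(0)| for a large
  -- derivative.
  have hT : p * (q * r) ≤ y / (1 + ε₁) + (1 + ε₁) ^ 2 * l * r ^ 2 := by
    refine abs_le_of_sq_le_sq' ?_ (by positivity) |>.2
    have h1 : (p * (q * r)) ^ 2 ≤ 4 * (y / (1 + ε₁)) * ((1 + ε₁) ^ 2 * l * r ^ 2) := by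
      calc (p * (q * r)) ^ 2 = (q ^ 2 * p ^ 2) * r ^ 2 := by ring
        _ ≤ (4 * (1 + ε₁) * l * y) * r ^ 2 := by gcongr
        _ = _ := by field_simp
    exact h1.trans (four_mul_le_sq_add _ _)
  have hinv : a ^ p ≤ Real.exp (-(y / (1 + ε₁))) := by
    have h1 : a ^ p ≤ (1 + y)⁻¹ := by
      rw [← one_div, le_div_iff₀ (by positivity)]; exact hay
    have h2 : y / (1 + ε₁) ≤ Real.log (1 + y) := by
      have h3 := Real.one_sub_inv_le_log_of_pos (x := 1 + y) (by positivity)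
      have h4 : y / (1 + ε₁) ≤ y / (1 + y) := by gcongr
      have h5 : y / (1 + y) = 1 - (1 + y)⁻¹ := by field_simp; ring
      linarith
    refine h1.trans ?_
    rw [Real.exp_neg]
    gcongr
    rwa [← Real.le_log_iff_exp_le (by positivity)]
  calc t ^ p
      ≤ (a * Real.exp (q * r + b * r ^ 2)) ^ p := by
        refine Real.rpow_le_rpow ht0 (haffine.trans ?_) hp.le
        gcongr
        rw [add_comm]
        exact Real.add_one_le_exp _
    _ = a ^ p * Real.exp ((q * r + b * r ^ 2) * p) := by
        rw [Real.mul_rpow ha0.le (Real.exp_pos _).le, ← Real.exp_mul]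
    _ ≤ Real.exp (-(y / (1 + ε₁))) * Real.exp ((q * r + b * r ^ 2) * p) := by gcongr
    _ = Real.exp (-(y / (1 + ε₁)) + (q * r + b * r ^ 2) * p) := (Real.exp_add _ _).symm
    _ ≤ Real.exp ((l + ε) * r ^ 2) := by
        rw [Real.exp_le_exp]
        have h1 : (1 + ε₁) ^ 2 * l * r ^ 2 ≤ (l + ε / 2) * r ^ 2 := by gcongr
        have h2 : p * b * r ^ 2 ≤ ε / 2 * r ^ 2 := by gcongr
        linarith

/-- Second-order upper bound at `r X` for functions of `p`-mean `1`. -/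
lemma eventually_norm_rpow_le_exp (hopen : IsOpen Ω) (h0 : 0 ∈ Ω)
    (hbdd : Bornology.IsBounded Ω) (hcirc : ∀ z ∈ Ω, ∀ t : ℂ, ‖t‖ ≤ 1 → t • z ∈ Ω) (hp : 0 < p)
    {X : Fin n → ℂ} (hX : X ≠ 0) {I : ℝ} (hI : 0 < I)
    (hmin : ∀ g : (Fin n → ℂ) →L[ℂ] ℂ, ‖g X‖ ^ (2 : ℝ) * I ≤ ∫ z in Ω, ‖g z‖ ^ (2 : ℝ))
    {ε : ℝ} (hε : 0 < ε) :
    ∀ᶠ r : ℝ in 𝓝[>] 0, ∀ f, MemBergman p Ω f → ∫ w in Ω, ‖f w‖ ^ p = volume.real Ω →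
      ‖f ((r : ℂ) • X)‖ ^ p ≤ Real.exp ((volume.real Ω / I + ε) * r ^ 2) := by
  set V := volume.real Ω with hV
  have hV0 : 0 < V := measureReal_pos_of_isOpen hopen h0 hbdd
  set l := V / I with hl
  have hl0 : 0 < l := div_pos hV0 hI
  have hXn : 0 < ‖X‖ := norm_pos_iff.mpr hX
  obtain ⟨ε₁, hε₁, hε₁l⟩ : ∃ ε₁ : ℝ, 0 < ε₁ ∧ (1 + ε₁) ^ 2 * l < l + ε / 2 := by
    have ht : Tendsto (fun x : ℝ => (1 + x) ^ 2 * l) (𝓝 0) (𝓝 ((1 + 0) ^ 2 * l)) :=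
      Continuous.tendsto (by fun_prop) 0
    have h1 := (ht.eventually_lt_const (u := l + ε / 2) (by simp; positivity)).filter_mono
      (nhdsWithin_le_nhds (s := Set.Ioi 0))
    obtain ⟨x, h2, h3⟩ := (h1.and self_mem_nhdsWithin).exists
    exact ⟨x, h3, h2⟩
  obtain ⟨τ, hτ, hcomp⟩ := exists_forall_setIntegral_le_mul hopen h0 hbdd hε₁
  obtain ⟨K, hK, hKΩ, hKcirc, ⟨ρ, hρ, hρK⟩, hKvol⟩ :=
    exists_compact_circled hopen h0 hbdd hcirc hτ
  set δ := ρ / ‖X‖ with hδ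
  have hδ0 : 0 < δ := by positivity
  -- The three bounds on ε₂ serve, in order, to exclude zeros on K while keeping |f(0)| ≥ 1/2, to
  -- force y ≤ ε₁, and to make the error of the affine approximation negligible.
  obtain ⟨ε₂, hε₂, hε₂half, hε₂p, hε₂δ⟩ : ∃ ε₂ : ℝ, 0 < ε₂ ∧ ε₂ < 1 / 2 ∧
      1 < (1 - ε₂) ^ p * (1 + ε₁) ∧ p * (64 * ε₂ / δ ^ 2) < ε / 2 := by
    have ht₁ : Tendsto (fun x : ℝ => (1 - x) ^ p * (1 + ε₁)) (𝓝 0)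
        (𝓝 ((1 - 0) ^ p * (1 + ε₁))) :=
      Continuous.tendsto (((continuous_const.sub continuous_id).rpow_const
        fun _ => Or.inr hp.le).mul continuous_const) 0
    have ht₂ : Tendsto (fun x : ℝ => p * (64 * x / δ ^ 2)) (𝓝 0)
        (𝓝 (p * (64 * 0 / δ ^ 2))) := Continuous.tendsto (by fun_prop) 0
    have h1 := ht₁.eventually_const_lt (u := 1) (by
      rw [sub_zero, Real.one_rpow]; linarith)
    have h2 := ht₂.eventually_lt_const (u := ε / 2) (by
      rw [mul_zero, zero_div, mul_zero]; positivity)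
    have h3 : ∀ᶠ x : ℝ in 𝓝 0, x < 1 / 2 := gt_mem_nhds (by norm_num)
    obtain ⟨x, ⟨h4, h5, h6⟩, h7⟩ := (((h1.and (h2.and h3)).filter_mono
      (nhdsWithin_le_nhds (s := Set.Ioi 0))).and self_mem_nhdsWithin).exists
    exact ⟨x, h7, h6, h4, h5⟩
  obtain ⟨η, hη, hnear⟩ := exists_forall_abs_norm_sub_one_le hopen h0 hbdd hcirc hp hK hKΩ
    hε₂ (by linarith)
  obtain ⟨C, hC, d, hd, hLip⟩ := exists_uniform_lipschitz hopen hp hK hKΩ V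
  have h0K : (0 : Fin n → ℂ) ∈ K := hρK (by simp [hρ.le])
  have hev : ∀ᶠ r : ℝ in 𝓝[>] 0, r < δ / 2 ∧ r * ‖X‖ < d ∧ C * (r * ‖X‖) < η := by
    have ht₁ : Tendsto (fun r : ℝ => r * ‖X‖) (𝓝 0) (𝓝 (0 * ‖X‖)) :=
      Continuous.tendsto (by fun_prop) 0
    have ht₂ : Tendsto (fun r : ℝ => C * (r * ‖X‖)) (𝓝 0) (𝓝 (C * (0 * ‖X‖))) :=
      Continuous.tendsto (by fun_prop) 0
    have h1 : ∀ᶠ r : ℝ in 𝓝 0, r < δ / 2 := gt_mem_nhds (by positivity)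
    have h2 := ht₁.eventually_lt_const (u := d) (by simpa using hd)
    have h3 := ht₂.eventually_lt_const (u := η) (by simpa using hη)
    exact (h1.and (h2.and h3)).filter_mono nhdsWithin_le_nhds
  filter_upwards [hev, self_mem_nhdsWithin] with r ⟨hrδ, hrd, hrη⟩ hr f hf hfV
  have hr0 : 0 < r := hr
  -- Only |f(rX)| ≥ 1 matters; the Lipschitz bound then puts |f(0)| near its maximum 1.
  rcases lt_or_ge ‖f ((r : ℂ) • X)‖ 1 with hlt | hge
  · refine (Real.rpow_le_one (norm_nonneg _) hlt.le hp.le).trans (Real.one_le_exp ?_)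
    positivity
  have hrX : ‖(r : ℂ) • X‖ = r * ‖X‖ := by
    rw [norm_smul, Complex.norm_real, Real.norm_of_nonneg hr0.le]
  set a := ‖f 0‖ with ha
  have haη : 1 - η ≤ a := by
    have h1 := (hLip f hf hfV.le 0 h0K).2 ((r : ℂ) • X) (by
      rw [mem_ball_zero_iff, hrX]; exact hrd)
    rw [sub_zero, hrX] at h1
    have h2 := norm_sub_norm_le (f ((r : ℂ) • X)) (f 0)
    linarith
  have hnearK := hnear f hf hfV haη
  have haε : 1 - ε₂ ≤ a := by
    have := abs_le.mp (hnearK 0 h0K); linarith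
  have ha0 : 0 < a := by linarith
  have hfne : ∀ z ∈ K, f z ≠ 0 := by
    intro z hz h
    have := abs_le.mp (hnearK z hz)
    rw [h, norm_zero] at this
    linarith
  set g : (Fin n → ℂ) →L[ℂ] ℂ := (f 0)⁻¹ • fderiv ℂ f 0 with hg
  set Q := ∫ z in K, ‖g z‖ ^ (2 : ℝ) with hQ
  have hQ0 : 0 ≤ Q := integral_nonneg fun z => by positivity
  set y := p ^ 2 / 4 * Q / V with hy
  have hy0 : 0 ≤ y := by positivity
  have hay : a ^ p * (1 + y) ≤ 1 := by
    have h1 := norm_rpow_mul_le_setIntegral hopen h0 hbdd hcirc hp hK hKΩ hKcirc hf hfne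
    rw [hfV, ← hV, ← ha, ← hg, ← hQ] at h1
    have h2 : V + p ^ 2 / 4 * Q = V * (1 + y) := by rw [hy]; field_simp
    rw [h2] at h1
    by_contra! h
    nlinarith
  have hap : 0 < a ^ p := Real.rpow_pos_of_pos ha0 p
  have hyε : y ≤ ε₁ := by
    have h1 : (1 - ε₂) ^ p ≤ a ^ p := Real.rpow_le_rpow (by linarith) haε hp.le
    by_contra! h
    have h2 : (1 - ε₂) ^ p * (1 + ε₁) ≤ a ^ p * (1 + y) := by gcongr
    linarith
  have hgX : ‖g X‖ ^ 2 * p ^ 2 ≤ 4 * (1 + ε₁) * l * y := by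
    have h1 := (hmin g).trans (hcomp K hK hKΩ hKvol g)
    rw [Real.rpow_two, ← le_div_iff₀ hI] at h1
    calc ‖g X‖ ^ 2 * p ^ 2 ≤ (1 + ε₁) * Q / I * p ^ 2 := by gcongr
      _ = 4 * (1 + ε₁) * l * y := by rw [hl, hy]; field_simp
  -- Here |f| ≤ 1 + ε₂ ≤ a + 2ε₂ gives the constant 32ε₂/δ², doubled when a ≥ 1/2 is factored out.
  have haffine : ‖f ((r : ℂ) • X)‖ ≤ a * (1 + (‖g X‖ * r + 64 * ε₂ / δ ^ 2 * r ^ 2)) := by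
    have hmemK : ∀ t ∈ ball (0 : ℂ) δ, t • X ∈ K := fun t ht => hρK (by
      rw [mem_closedBall_zero_iff, norm_smul]
      have : ‖t‖ < δ := by simpa using ht
      calc ‖t‖ * ‖X‖ ≤ δ * ‖X‖ := by gcongr
        _ = ρ := by rw [hδ]; field_simp)
    have h1 := norm_le_of_norm_le_add (h := fun t : ℂ => f (t • X)) (μ := 2 * ε₂) hδ0
      (by positivity) ((differentiableOn_slice hf.1 X).mono fun t ht => hKΩ (hmemK t ht))
      (fun t ht => by
        have := abs_le.mp (hnearK _ (hmemK t ht))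
        simp only [zero_smul, ← ha]
        linarith) (z := (r : ℂ)) (by
          rwa [Complex.norm_real, Real.norm_of_nonneg hr0.le])
    rw [deriv_slice hopen h0 hf.1, Complex.norm_real, Real.norm_of_nonneg hr0.le] at h1
    simp only [zero_smul, ← ha] at h1
    have h2 : ‖fderiv ℂ f 0 X‖ = a * ‖g X‖ := by
      rw [hg, smul_apply, smul_eq_mul, norm_mul, norm_inv, ← ha]; field_simp
    rw [h2] at h1
    have h3 : 16 * (2 * ε₂) / δ ^ 2 * r ^ 2 ≤ a * (64 * ε₂ / δ ^ 2 * r ^ 2) := by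
      have : 0 ≤ ε₂ / δ ^ 2 * r ^ 2 := by positivity
      calc 16 * (2 * ε₂) / δ ^ 2 * r ^ 2 = 32 * (ε₂ / δ ^ 2 * r ^ 2) := by ring
        _ ≤ (64 * a) * (ε₂ / δ ^ 2 * r ^ 2) := by gcongr; linarith
        _ = _ := by ring
    linarith
  exact rpow_le_exp_of_le_mul hp hl0 hε₁ ha0 hr0 (norm_nonneg _) hy0 hyε
    hε₁l.le hε₂δ.le hay hgX haffine

/-- Upper bound for the kernel near the centre. -/
lemma eventually_bergmanKernel_le_exp (hopen : IsOpen Ω) (h0 : 0 ∈ Ω)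
    (hbdd : Bornology.IsBounded Ω) (hcirc : ∀ z ∈ Ω, ∀ t : ℂ, ‖t‖ ≤ 1 → t • z ∈ Ω) (hp : 0 < p)
    {X : Fin n → ℂ} (hX : X ≠ 0) {I : ℝ} (hI : 0 < I)
    (hmin : ∀ g : (Fin n → ℂ) →L[ℂ] ℂ, ‖g X‖ ^ (2 : ℝ) * I ≤ ∫ z in Ω, ‖g z‖ ^ (2 : ℝ))
    {ε : ℝ} (hε : 0 < ε) :
    ∀ᶠ r : ℝ in 𝓝[>] 0, volume.real Ω * bergmanKernel p Ω ((r : ℂ) • X)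
      ≤ Real.exp ((volume.real Ω / I + ε) * r ^ 2) := by
  have hV := measureReal_pos_of_isOpen hopen h0 hbdd
  have hmem : ∀ᶠ r : ℝ in 𝓝[>] 0, (r : ℂ) • X ∈ Ω := by
    have : Tendsto (fun r : ℝ => (r : ℂ) • X) (𝓝 0) (𝓝 (((0 : ℝ) : ℂ) • X)) :=
      Continuous.tendsto (by fun_prop) 0
    exact (this.eventually_mem (by simpa using hopen.mem_nhds h0)).filter_mono nhdsWithin_le_nhds
  filter_upwards [eventually_norm_rpow_le_exp hopen h0 hbdd hcirc hp hX hI hmin hε, hmem]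
    with r hr hrX
  rw [mul_comm, ← le_div_iff₀ hV]
  refine bergmanKernel_le hp (by positivity) fun f hf => ?_
  set J := ∫ w in Ω, ‖f w‖ ^ p with hJ
  have hJ0 : 0 ≤ J := integral_nonneg fun z => by positivity
  rcases hJ0.eq_or_lt with hJz | hJpos
  · obtain ⟨C, -, hC⟩ := exists_norm_rpow_le hopen hp hrX
    have := hC f hf
    rw [← hJ, ← hJz, mul_zero] at this
    simpa [← hJz] using this
  · set c : ℝ := (volume.real Ω / J) ^ (1 / p) with hc
    have hcn : ∀ z, ‖(c : ℂ) * f z‖ ^ p = volume.real Ω / J * ‖f z‖ ^ p := fun z => by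
      rw [norm_mul, Complex.norm_real, Real.norm_of_nonneg (by positivity),
        Real.mul_rpow (by positivity) (norm_nonneg _), hc, ← Real.rpow_mul (by positivity),
        one_div_mul_cancel hp.ne', Real.rpow_one]
    have hmem' : MemBergman p Ω fun z => (c : ℂ) * f z := by
      refine ⟨hf.1.const_mul _, ?_⟩
      simp only [hcn]
      exact hf.2.const_mul _
    have h1 := hr _ hmem' (by
      simp only [hcn]
      rw [integral_const_mul, ← hJ]; field_simp)
    rw [hcn, div_mul_eq_mul_div, div_le_iff₀ hJpos] at h1
    rw [div_mul_eq_mul_div, le_div_iff₀ hV]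
    linarith

/-- By rotation invariance the quotient is log(V K_p(rX)) / r², squeezed between log(1 + l r²) / r²
and l + ε; p drops out of the limit. -/
lemma hasLeviForm_log_bergmanKernel (hopen : IsOpen Ω) (h0 : 0 ∈ Ω)
    (hbdd : Bornology.IsBounded Ω) (hcirc : ∀ z ∈ Ω, ∀ t : ℂ, ‖t‖ ≤ 1 → t • z ∈ Ω) (hp : 0 < p)
    {X : Fin n → ℂ} {g₀ : (Fin n → ℂ) →L[ℂ] ℂ} (hg₀ : g₀ X = 1)
    (hmin : ∀ g : (Fin n → ℂ) →L[ℂ] ℂ,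
      ‖g X‖ ^ (2 : ℝ) * ∫ z in Ω, ‖g₀ z‖ ^ (2 : ℝ) ≤ ∫ z in Ω, ‖g z‖ ^ (2 : ℝ)) :
    HasLeviForm (fun z => Real.log (bergmanKernel p Ω z)) 0 X
      (volume.real Ω / ∫ z in Ω, ‖g₀ z‖ ^ (2 : ℝ)) := by
  have hV := measureReal_pos_of_isOpen hopen h0 hbdd
  have hg0 : g₀ ≠ 0 := by rintro rfl; simp at hg₀
  have hX : X ≠ 0 := by rintro rfl; simp at hg₀
  have hI := setIntegral_norm_rpow_pos hopen h0 hbdd two_pos hg0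
  set I := ∫ z in Ω, ‖g₀ z‖ ^ (2 : ℝ) with hIdef
  set V := volume.real Ω with hVdef
  set l := V / I with hl
  have hl0 : 0 < l := div_pos hV hI
  have hcirceq : ∀ r : ℝ, 0 < r → ∀ t ∈ sphere (0 : ℂ) |r|,
      Real.log (bergmanKernel p Ω (0 + t • X))
        = Real.log (bergmanKernel p Ω ((r : ℂ) • X)) := by
    intro r hr t ht
    have htn : ‖t‖ = r := by simpa [abs_of_pos hr] using ht
    have hr0 : (r : ℂ) ≠ 0 := by exact_mod_cast hr.ne'
    have h1 : ‖t / r‖ = 1 := by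
      rw [norm_div, htn, Complex.norm_real, Real.norm_of_nonneg hr.le, div_self hr.ne']
    rw [zero_add, ← bergmanKernel_rotation hopen hcirc hp h1 ((r : ℂ) • X), smul_smul,
      div_mul_cancel₀ _ hr0]
  constructor
  · filter_upwards [self_mem_nhdsWithin] with r hr
    have hr0 : 0 < r := hr
    have hconst : (fun θ : ℝ => Real.log (bergmanKernel p Ω (0 + circleMap 0 r θ • X)))
        = fun _ => Real.log (bergmanKernel p Ω ((r : ℂ) • X)) :=
      funext fun θ => hcirceq r hr0 _ (by simp)
    rw [circleIntegrable_def, hconst]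
    exact intervalIntegrable_const
  · have hlow := (one_add_le_bergmanKernel (p := p) hopen h0 hbdd hcirc hp hg₀).filter_mono
      (nhdsWithin_le_nhds (s := Set.Ioi 0))
    rw [← hIdef, ← hVdef, ← hl] at hlow
    have hlog0 : Real.log (bergmanKernel p Ω 0) = -Real.log V := by
      rw [bergmanKernel_zero hopen h0 hbdd hcirc hp, Real.log_inv]
    have hquot : ∀ᶠ r : ℝ in 𝓝[>] 0,
        (circleAverage (fun t : ℂ => Real.log (bergmanKernel p Ω (0 + t • X))) 0 r
          - Real.log (bergmanKernel p Ω 0)) / r ^ 2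
          = Real.log (V * bergmanKernel p Ω ((r : ℂ) • X)) / r ^ 2 := by
      filter_upwards [self_mem_nhdsWithin, hlow] with r hr hrl
      have hpos : 0 < V * bergmanKernel p Ω ((r : ℂ) • X) :=
        lt_of_lt_of_le (by positivity) hrl
      have hK : bergmanKernel p Ω ((r : ℂ) • X) ≠ 0 := (pos_of_mul_pos_right hpos hV.le).ne'
      rw [circleAverage_const_on_circle (hcirceq r hr), hlog0, Real.log_mul hV.ne' hK]
      ring
    refine Tendsto.congr' (EventuallyEq.symm hquot) ?_
    rw [tendsto_order]
    constructor
    · intro m hm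
      have ht : Tendsto (fun r : ℝ => l / (1 + l * r ^ 2)) (𝓝 0) (𝓝 (l / (1 + l * 0 ^ 2))) := by
        refine ContinuousAt.tendsto (f := fun r : ℝ => l / (1 + l * r ^ 2)) ?_
        exact ContinuousAt.div (by fun_prop) (by fun_prop) (by simp)
      have hm' := (ht.eventually_const_lt (u := m) (by simpa using hm)).filter_mono
        (nhdsWithin_le_nhds (s := Set.Ioi 0))
      filter_upwards [self_mem_nhdsWithin, hlow, hm'] with r hr hrl hrm
      have hr0 : 0 < r := hr
      refine hrm.trans_le ?_
      have h1 : 0 < 1 + l * r ^ 2 := by positivity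
      rw [le_div_iff₀ (by positivity)]
      calc l / (1 + l * r ^ 2) * r ^ 2 = 1 - (1 + l * r ^ 2)⁻¹ := by field_simp; ring
        _ ≤ Real.log (1 + l * r ^ 2) := Real.one_sub_inv_le_log_of_pos h1
        _ ≤ _ := Real.log_le_log h1 hrl
    · intro m hm
      have hup := eventually_bergmanKernel_le_exp hopen h0 hbdd hcirc hp hX hI hmin
        (ε := (m - l) / 2) (by linarith)
      filter_upwards [self_mem_nhdsWithin, hlow, hup] with r hr hrl hru
      have hr0 : 0 < r := hr
      have hpos : 0 < V * bergmanKernel p Ω ((r : ℂ) • X) :=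
        lt_of_lt_of_le (by positivity) hrl
      rw [div_lt_iff₀ (by positivity)]
      calc _ ≤ (l + (m - l) / 2) * r ^ 2 := by
            rw [Real.log_le_iff_le_exp hpos]; exact hru
        _ < m * r ^ 2 := by gcongr; linarith

end LeviForm

/-! ### Comparison of the two extremal problems -/

theorem theorem1p1 {n : ℕ} (Ω : Set (Fin n → ℂ)) (hopen : IsOpen Ω) (hconn : IsConnected Ω)
    (hbdd : Bornology.IsBounded Ω) (hcirc : ∀ z ∈ Ω, ∀ t : ℂ, ‖t‖ ≤ 1 → t • z ∈ Ω)
    (p : ℝ) (hp : 0 < p) (X : Fin n → ℂ) (hX : X ≠ 0) :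
    (2 < p → ∃ L : ℝ, HasLeviForm (fun z => Real.log (bergmanKernel p Ω z)) 0 X L ∧
      bergmanMetric p Ω 0 X ^ 2 < L) ∧
    (p < 2 → ∃ L : ℝ, HasLeviForm (fun z => Real.log (bergmanKernel p Ω z)) 0 X L ∧
      L < bergmanMetric p Ω 0 X ^ 2) := by
  obtain ⟨w, hw⟩ := hconn.nonempty
  have h0 : (0 : Fin n → ℂ) ∈ Ω := by simpa using hcirc w hw 0 (by simp)
  have hV := measureReal_pos_of_isOpen hopen h0 hbdd
  obtain ⟨g₂, hg₂, hmin₂⟩ := exists_minimal_functional hopen h0 hbdd two_pos hX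
  obtain ⟨gp, hgp, hminp⟩ := exists_minimal_functional hopen h0 hbdd hp hX
  have hg₂0 : g₂ ≠ 0 := by rintro rfl; simp at hg₂
  have hgp0 : gp ≠ 0 := by rintro rfl; simp at hgp
  have hI₂ := setIntegral_norm_rpow_pos hopen h0 hbdd two_pos hg₂0
  have hIp := setIntegral_norm_rpow_pos hopen h0 hbdd hp hgp0
  have hLevi := hasLeviForm_log_bergmanKernel hopen h0 hbdd hcirc hp hg₂ hmin₂
  -- Each minimizer competes in the other's problem. Jensen is then applied to the minimizer for the
  -- larger exponent: `gp` if p > 2, `g₂` if p < 2.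
  have h₂p := hmin₂ gp
  have hp₂ := hminp g₂
  rw [hgp, norm_one, Real.one_rpow, one_mul] at h₂p
  rw [hg₂, norm_one, Real.one_rpow, one_mul] at hp₂
  rw [bergmanMetric_zero hopen h0 hbdd hcirc hp hgp hminp]
  set V := volume.real Ω
  set I₂ := ∫ z in Ω, ‖g₂ z‖ ^ (2 : ℝ)
  set Ip := ∫ z in Ω, ‖gp z‖ ^ p
  have hsq : ((I₂ / V) ^ (1 / 2 : ℝ)) ^ 2 = I₂ / V := by
    rw [← Real.sqrt_eq_rpow, Real.sq_sqrt (by positivity)]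
  have hLeq : V / I₂ = (((I₂ / V) ^ (1 / 2 : ℝ))⁻¹) ^ 2 := by
    rw [inv_pow, hsq, inv_div]
  have h2pos : 0 < (I₂ / V) ^ (1 / 2 : ℝ) := by positivity
  have hppos : 0 < (Ip / V) ^ (1 / p) := by positivity
  refine ⟨fun h => ⟨_, hLevi, ?_⟩, fun h => ⟨_, hLevi, ?_⟩⟩
  · have h1 := average_norm_rpow_strict hopen h0 hbdd two_pos h hgp0
    have h2 : (I₂ / V) ^ (1 / 2 : ℝ) < (Ip / V) ^ (1 / p) :=
      lt_of_le_of_lt (by gcongr) h1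
    rw [hLeq]
    gcongr
  · have h1 := average_norm_rpow_strict hopen h0 hbdd hp h hg₂0
    have h2 : (Ip / V) ^ (1 / p) < (I₂ / V) ^ (1 / 2 : ℝ) :=
      lt_of_le_of_lt (by gcongr) h1
    rw [hLeq]
    gcongr
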